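/- Let $k\ge 0$ and let $L^2(|x|^{2k}dx)$ be the space of complex-valued functions on $\mathbb R$ that are square integrable for the measure $|x|^{2k}dx$, with $\langle F,g\rangle=\int_{\mathbb R}F(x)\overline{g(x)}\,|x|^{2k}dx$. Let $L_n^\alpha$ denote the Laguerre polynomials and let $h_n^k$, $n\ge 0$, be the Dunkl--Hermite functions $$h_{2n}^k(x)=(-1)^n\sqrt{\tfrac{n!}{\Gamma(n+k+\frac12)}}\;e^{-x^2/2}L_n^{k-\frac12}(x^2),\qquad h_{2n+1}^k(x)=(-1)^n\sqrt{\tfrac{n!}{\Gamma(n+k+\frac32)}}\;e^{-x^2/2}\,x\,L_n^{k+\frac12}(x^2),$$ with $h_{-1}^k=0$. For $F\in L^2(|x|^{2k}dx)$ let $a_n^k(F)=\int_{\mathbb R}F(t)h_n^k(t)|t|^{2k}dt$. Let $\theta(n,k)=\sqrt{2n}$ for even $n$ and $\theta(n,k)=\sqrt{2n+4k}$ for odd $n$, and define the Hilbert transforms by the series $$\mathcal H_k^+F=\sum_{n\ge0}a_n^k(F)\frac{\theta(n,k)}{\sqrt{2n+2k+1}}\,h_{n-1}^k,\qquad \mathcal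 H_k^-F=-\sum_{n\ge0}a_n^k(F)\frac{\theta(n+1,k)}{\sqrt{2n+2k+1}}\,h_{n+1}^k .$$ Let $T_k\varphi(x)=\varphi'(x)+k\,\frac{\varphi(x)-\varphi(-x)}{x}$ be the Dunkl operator (at $x=0$ the quotient is read as its limit $2\varphi'(0)$), let $$P_k(t,x,y)=\sum_{n\ge0}e^{-t(2n+2k+1)}h_n^k(x)h_n^k(y)\qquad(t>0),$$ and let, with $T_{k,x}$ denoting $T_k$ acting in the variable $x$, $$R_k^\pm(x,y)=\frac1{\sqrt\pi}\int_0^\infty (T_{k,x}\pm x)P_k(t,x,y)\,t^{-1/2}\,dt .$$ These objects are well defined: the series for $\mathcal H_k^\pm F$ converge in $L^2(|x|^{2k}dx)$ for every $F$ in that space; the series for $P_k(t,x,y)$ converges for all $t>0$ and $x,y\in\mathbb R$, and its sum is differentiable in $x$; and the integrals defining $R_k^\pm(x,y)$ converge absolutely whenever $|x|\ne|y|$, hence for almost every $(x,y)$. Moreover, let $f,g\in C_c^\infty(\mathbb R)$ be complex-valued functions with disjoint (closed) supports. Then the function $(x,y)\mapsto R_k^\pm(x,y)f(y)\overline{g(x)}$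 is integrable for the measure $|x|^{2k}dx\,|y|^{2k}dy$, and $$\langle\mathcal H_k^\pm f,g\rangle=\int_{\mathbb R}\int_{\mathbb R}R_k^\pm(x,y)f(y)\overline{g(x)}\,|y|^{2k}dy\,|x|^{2k}dx .$$ -/

import Mathlib

open MeasureTheory Set
open scoped NNReal ENNReal ContDiff ComplexConjugate

noncomputable section

namespace DunklHermite

/-- The Laguerre polynomial `L_n^α` evaluated at `x`:
`∑_{i=0}^n (-1)^i Γ(n+α+1) / (Γ(α+i+1) (n-i)! i!) x^i` (for `α > -1`).
Its Rodrigues formula is `laguerre_eq_rodrigues` below. -/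
def laguerre (α : ℝ) (n : ℕ) (x : ℝ) : ℝ :=
  ∑ i ∈ Finset.range (n + 1),
    (-1) ^ i * (Real.Gamma (n + α + 1) /
      (Real.Gamma (α + i + 1) * ((n - i).factorial : ℝ) * (i.factorial : ℝ))) * x ^ i

theorem descPochhammer_mul_Gamma (r : ℝ) (m : ℕ) (h : 0 < r - m + 1) :
    (descPochhammer ℝ m).eval r * Real.Gamma (r - m + 1) = Real.Gamma (r + 1) := by
  induction m with
  | zero => simp
  | succ m ih =>
    push_cast at h ⊢
    have h1 : 0 < r - m := by linarith
    rw [descPochhammer_succ_right, ← ih (by linarith), Real.Gamma_add_one h1.ne']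
    simp only [Polynomial.eval_mul, Polynomial.eval_sub, Polynomial.eval_X,
      Polynomial.eval_natCast]
    rw [show r - (m + 1) + 1 = r - m by ring]
    ring

/-- `L_n^α(x) = (1/n!) x^{-α} e^x (d/dx)^n (x^{n+α} e^{-x})`. -/
theorem laguerre_eq_rodrigues (α : ℝ) (hα : -1 < α) (n : ℕ) (x : ℝ) (hx : 0 < x) :
    laguerre α n x = 1 / (n.factorial : ℝ) * x ^ (-α) * Real.exp x *
      iteratedDeriv n (fun u : ℝ => u ^ ((n : ℝ) + α) * Real.exp (-u)) x := by
  have h1 : (fun u : ℝ => u ^ ((n : ℝ) + α) * Real.exp (-u)) =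
      fun u : ℝ => Real.exp ((-1) * u) * u ^ ((n : ℝ) + α) := by
    funext u; rw [mul_comm]; simp
  rw [h1, iteratedDeriv_fun_mul (by fun_prop) (Real.contDiffAt_rpow_const_of_ne hx.ne'), laguerre,
    Finset.mul_sum]
  refine Finset.sum_congr rfl fun i hi => ?_
  have hin : i ≤ n := Nat.lt_succ_iff.mp (Finset.mem_range.mp hi)
  rw [iteratedDeriv_exp_const_mul, iteratedDeriv_eq_iterate, Real.iter_deriv_rpow_const]
  have hc : ((n - i : ℕ) : ℝ) = n - i := by push_cast [hin]; ring
  have hpos : 0 < α + i + 1 := by linarith [(Nat.cast_nonneg i : (0 : ℝ) ≤ i)]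
  have hG := descPochhammer_mul_Gamma ((n : ℝ) + α) (n - i) (by rw [hc]; linarith)
  rw [hc, show (n : ℝ) + α - (n - i) + 1 = α + i + 1 by ring] at hG
  rw [hc, ← hG, show (n : ℝ) + α - (n - i) = α + i by ring, Real.rpow_add hx, Real.rpow_neg hx.le,
    Real.rpow_natCast, Nat.choose_eq_factorial_div_factorial hin,
    Nat.cast_div (Nat.factorial_mul_factorial_dvd_factorial hin) (by positivity)]
  have hΓ := (Real.Gamma_pos_of_pos hpos).ne'
  have hxα := (Real.rpow_pos_of_pos hx α).ne'
  have he : Real.exp x * Real.exp (-x) = 1 := by rw [← Real.exp_add]; simp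
  push_cast
  field_simp
  linear_combination (-((descPochhammer ℝ (n - i)).eval ((n : ℝ) + α))) * he

/-- The generalized Hermite (Dunkl--Hermite) function `h_n^k(x) = e^{-x²/2} H_n^k(x)`. -/
def hermiteFun (k : ℝ≥0) (n : ℕ) (x : ℝ) : ℝ :=
  Real.exp (-x ^ 2 / 2) *
    if Even n then
      (-1) ^ (n / 2) * √(((n / 2).factorial : ℝ) / Real.Gamma ((n / 2 : ℕ) + (k : ℝ) + 1 / 2)) *
        laguerre ((k : ℝ) - 1 / 2) (n / 2) (x ^ 2)
    else
      (-1) ^ (n / 2) * √(((n / 2).factorial : ℝ) / Real.Gamma ((n / 2 : ℕ) + (k : ℝ) + 3 / 2)) *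
        (x * laguerre ((k : ℝ) + 1 / 2) (n / 2) (x ^ 2))

/-- The measure `|x|^{2k} dx` on `ℝ`. -/
def weightedMeasure (k : ℝ≥0) : Measure ℝ :=
  volume.withDensity fun x => ENNReal.ofReal (|x| ^ (2 * (k : ℝ)))

instance instIsLocallyFiniteMeasureWeightedMeasure (k : ℝ≥0) :
    IsLocallyFiniteMeasure (weightedMeasure k) :=
  IsLocallyFiniteMeasure.withDensity_ofReal
    (continuous_abs.rpow_const fun _ => Or.inr (by positivity))

/-- The Dunkl operator `T_k φ(x) = φ'(x) + k (φ(x) - φ(-x)) / x`, with the quotient replaced by its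
limit `2 φ'(0)` at `x = 0`. -/
def dunklOp (k : ℝ≥0) (φ : ℝ → ℝ) (x : ℝ) : ℝ :=
  deriv φ x + k * if x = 0 then 2 * deriv φ 0 else (φ x - φ (-x)) / x

/-- The heat kernel `P_k(t,x,y) = ∑ e^{-t(2n+2k+1)} h_n^k(x) h_n^k(y)`. -/
def heatKernel (k : ℝ≥0) (t x y : ℝ) : ℝ :=
  ∑' n : ℕ, Real.exp (-t * (2 * n + 2 * k + 1)) * hermiteFun k n x * hermiteFun k n y

/-- `((T_{k,x} + x) P_k(t,·,y))(x) t^{-1/2}`. -/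
def integrandPlus (k : ℝ≥0) (x y t : ℝ) : ℝ :=
  (dunklOp k (fun u => heatKernel k t u y) x + x * heatKernel k t x y) * t ^ (-(1 / 2) : ℝ)

/-- `((T_{k,x} - x) P_k(t,·,y))(x) t^{-1/2}`. -/
def integrandMinus (k : ℝ≥0) (x y t : ℝ) : ℝ :=
  (dunklOp k (fun u => heatKernel k t u y) x - x * heatKernel k t x y) * t ^ (-(1 / 2) : ℝ)

/-- The kernel `R_k^+(x,y) = π^{-1/2} ∫_0^∞ (T_{k,x} + x) P_k(t,x,y) t^{-1/2} dt`. The integral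
converges absolutely for `|x| ≠ |y|`, hence for almost every `(x,y)`. -/
def kernelPlus (k : ℝ≥0) (x y : ℝ) : ℝ :=
  1 / √Real.pi * ∫ t in Ioi (0 : ℝ), integrandPlus k x y t

/-- The kernel `R_k^-(x,y) = π^{-1/2} ∫_0^∞ (T_{k,x} - x) P_k(t,x,y) t^{-1/2} dt`. -/
def kernelMinus (k : ℝ≥0) (x y : ℝ) : ℝ :=
  1 / √Real.pi * ∫ t in Ioi (0 : ℝ), integrandMinus k x y t

/-- `θ(n,k) = √(2n)` for even `n` and `√(2n+4k)` for odd `n`. -/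
def theta (n : ℕ) (k : ℝ≥0) : ℝ :=
  if Even n then √(2 * n) else √(2 * n + 4 * k)

theorem memLp_monomial_gauss (k : ℝ≥0) (c : ℝ) (j : ℕ) :
    MemLp (fun x : ℝ => c * (x ^ j * Real.exp (-x ^ 2 / 2))) 2 (weightedMeasure k) := by
  refine MemLp.const_mul ?_ c
  rw [memLp_two_iff_integrable_sq (by fun_prop), weightedMeasure,
    integrable_withDensity_iff (by fun_prop) (by simp)]
  obtain ⟨M, hM⟩ := exists_nat_ge (k : ℝ)
  have hint : ∀ m : ℕ, Integrable fun x : ℝ => x ^ m * Real.exp (-1 * x ^ 2) := fun m => by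
    have h := integrable_rpow_mul_exp_neg_mul_sq (b := 1) one_pos (s := m)
      (by linarith [(Nat.cast_nonneg m : (0 : ℝ) ≤ m)])
    simpa only [Real.rpow_natCast] using h
  refine ((hint (2 * j)).add (hint (2 * j + 2 * M))).mono'
    (by fun_prop) (Filter.Eventually.of_forall fun x => ?_)
  have hw : |x| ^ (2 * (k : ℝ)) ≤ 1 + x ^ (2 * M) := by
    have hx2 : 0 ≤ x ^ (2 * M) := (even_two_mul M).pow_nonneg x
    rcases le_total |x| 1 with h | h
    · linarith [Real.rpow_le_one (abs_nonneg x) h (by positivity : 0 ≤ 2 * (k : ℝ))]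
    · have h2 := Real.rpow_le_rpow_of_exponent_le h (by push_cast; linarith :
        2 * (k : ℝ) ≤ ((2 * M : ℕ) : ℝ))
      rw [Real.rpow_natCast, (even_two_mul M).pow_abs] at h2
      linarith
  have hsq : (x ^ j * Real.exp (-x ^ 2 / 2)) ^ 2 = x ^ (2 * j) * Real.exp (-1 * x ^ 2) := by
    rw [mul_pow, ← pow_mul, mul_comm j 2, ← Real.exp_nat_mul]
    congr 2; push_cast; ring
  have h0 : 0 ≤ x ^ (2 * j) * Real.exp (-1 * x ^ 2) := by rw [← hsq]; positivity
  rw [hsq, ENNReal.toReal_ofReal (by positivity), Real.norm_of_nonneg (by positivity)]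
  calc _ ≤ x ^ (2 * j) * Real.exp (-1 * x ^ 2) * (1 + x ^ (2 * M)) :=
        mul_le_mul_of_nonneg_left hw h0
    _ = _ := by simp only [Pi.add_apply]; ring

theorem memLp_laguerre_gauss (k : ℝ≥0) (c α : ℝ) (m j : ℕ) :
    MemLp (fun x : ℝ => c * (x ^ j * Real.exp (-x ^ 2 / 2) * laguerre α m (x ^ 2))) 2
      (weightedMeasure k) := by
  have h := memLp_finsetSum (Finset.range (m + 1)) (μ := weightedMeasure k) (p := 2)
    (f := fun i (x : ℝ) => (c * ((-1) ^ i * (Real.Gamma (m + α + 1) /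
      (Real.Gamma (α + i + 1) * ((m - i).factorial : ℝ) * (i.factorial : ℝ))))) *
        (x ^ (j + 2 * i) * Real.exp (-x ^ 2 / 2)))
    fun i _ => memLp_monomial_gauss k _ (j + 2 * i)
  convert h using 2 with x
  simp only [laguerre, Finset.mul_sum]
  refine Finset.sum_congr rfl fun i _ => ?_
  rw [pow_add, pow_mul]; ring

theorem memLp_hermiteFun (k : ℝ≥0) (n : ℕ) :
    MemLp (fun x => (hermiteFun k n x : ℂ)) 2 (weightedMeasure k) := by
  refine MemLp.ofReal (f := hermiteFun k n) ?_
  by_cases hn : Even n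
  · convert memLp_laguerre_gauss k ((-1) ^ (n / 2) *
      √(((n / 2).factorial : ℝ) / Real.Gamma ((n / 2 : ℕ) + (k : ℝ) + 1 / 2)))
      ((k : ℝ) - 1 / 2) (n / 2) 0 using 2 with x
    simp only [hermiteFun, if_pos hn]; ring
  · convert memLp_laguerre_gauss k ((-1) ^ (n / 2) *
      √(((n / 2).factorial : ℝ) / Real.Gamma ((n / 2 : ℕ) + (k : ℝ) + 3 / 2)))
      ((k : ℝ) + 1 / 2) (n / 2) 1 using 2 with x
    simp only [hermiteFun, if_neg hn]; ring

/-- `h_n^k` as an element of `L²(ℝ, |x|^{2k} dx)`. -/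
def hermiteLp (k : ℝ≥0) (n : ℕ) : Lp ℂ 2 (weightedMeasure k) :=
  (memLp_hermiteFun k n).toLp _

/-- The coefficient `a_n^k(f) = ∫ f(t) h_n^k(t) |t|^{2k} dt`. -/
def coeff (k : ℝ≥0) (n : ℕ) (f : Lp ℂ 2 (weightedMeasure k)) : ℂ :=
  ∫ t, f t * (hermiteFun k n t : ℂ) ∂(weightedMeasure k)

/-- The `n`-th term of `H_k^+ f`, with the convention `h_{-1}^k = 0`. -/
def hilbertPlusTerm (k : ℝ≥0) (f : Lp ℂ 2 (weightedMeasure k)) (n : ℕ) :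
    Lp ℂ 2 (weightedMeasure k) :=
  (coeff k n f * ((theta n k / √(2 * n + 2 * k + 1) : ℝ) : ℂ)) •
    (if n = 0 then 0 else hermiteLp k (n - 1))

/-- The `n`-th term of the series whose negative is `H_k^- f`. -/
def hilbertMinusTerm (k : ℝ≥0) (f : Lp ℂ 2 (weightedMeasure k)) (n : ℕ) :
    Lp ℂ 2 (weightedMeasure k) :=
  (coeff k n f * ((theta (n + 1) k / √(2 * n + 2 * k + 1) : ℝ) : ℂ)) • hermiteLp k (n + 1)

/-- The Hilbert transform `H_k^+` on `L²(ℝ, |x|^{2k} dx)`, a series converging in `L²`. -/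
def hilbertPlus (k : ℝ≥0) (f : Lp ℂ 2 (weightedMeasure k)) : Lp ℂ 2 (weightedMeasure k) :=
  ∑' n : ℕ, hilbertPlusTerm k f n

/-- The Hilbert transform `H_k^-` on `L²(ℝ, |x|^{2k} dx)`, a series converging in `L²`. -/
def hilbertMinus (k : ℝ≥0) (f : Lp ℂ 2 (weightedMeasure k)) : Lp ℂ 2 (weightedMeasure k) :=
  -∑' n : ℕ, hilbertMinusTerm k f n

/-- The class in `L²(ℝ, |x|^{2k} dx)` of a continuous compactly supported function. -/
def toL2 (k : ℝ≥0) (f : ℝ → ℂ) (hf : Continuous f) (hc : HasCompactSupport f) :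
    Lp ℂ 2 (weightedMeasure k) :=
  (hf.memLp_of_hasCompactSupport (μ := weightedMeasure k) (p := 2) hc).toLp f

/-- `⟨F, g⟩ = ∫ F(x) conj(g(x)) |x|^{2k} dx`. -/
def pairing (k : ℝ≥0) (F g : ℝ → ℂ) : ℂ :=
  ∫ x, F x * conj (g x) ∂(weightedMeasure k)

end DunklHermite

end

/-! The functions `hermiteFun k n` are orthonormal, with eigenvalues λ_n = 2n+2k+1, and T_k + x and
T_k - x act on them as lowering and raising operators with factors θ(n,k) and -θ(n+1,k). Since
λ^(-1/2) = π^(-1/2) ∫ e^(-tλ) t^(-1/2) dt, the transform H^± is formally (T_k ± x) L^(-1/2), where L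
has these eigenvalues, and its kernel is the stated time integral. The work lies in justifying the
exchanges of series and integrals.

Closed form. The Hille-Hardy formula (`hasSum_hilleHardy`), applied separately to even and odd
indices, gives the Mehler formula `hasSum_heatKernel`. On the closed form T_k acts as multiplication
by an explicit factor (`dunklOp_mehlerKernel`). The series is never differentiated termwise: the
raising and lowering series are found by solving the linear system that the three-term recurrence
yields (`hasSum_raising`, `hasSum_lowering`).

Bounds. Disjoint supports keep x away from y but not from -y. Away from |x| = |y| the Gaussian
factor beats every power of 1/sinh(2t). Near y = -x the Mehler kernel contains the difference of the
even and odd parts of the Dunkl kernel, which is smaller than the even part by a factor of order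
sinh(2t) (`mul_dunklEven_sub_dunklOdd_le`); this pays for the 1/sinh(2t) created by T_k ± x. What
remains is the even part `mehlerEven`. Multiplied by t^(-1/2) it need not be integrable in t for
fixed x, y, but its integral over a square is O(e^(-t)) by Bessel's inequality
(`exists_integral_mehlerEven_le`). Hence `integrable_ladderKernel_prod`, the hypothesis of Fubini's
theorem.

Conclusion. `rieszKernel_representation` exchanges the series first with the space integrals at
fixed t, using the exponential decay, and then with the t-integral, using square summability of the
coefficients. Orthonormality itself comes from the symmetry of multiplication by 2x. -/

noncomputable section

namespace DunklHermite

/-! ### Laguerre polynomials in two normalizations -/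

/-- `Γ(n+α+1) / n!`. -/
def laguerreWeight (α : ℝ) (n : ℕ) : ℝ := Real.Gamma (n + α + 1) / n.factorial

/-- The Laguerre polynomial divided by `laguerreWeight`. -/
def lag (α : ℝ) (n : ℕ) (x : ℝ) : ℝ :=
  ∑ i ∈ Finset.range (n + 1), (n.choose i : ℝ) * (-x) ^ i / Real.Gamma (α + i + 1)

theorem Gamma_shift_pos {α : ℝ} (hα : -1 < α) (i : ℕ) : 0 < Real.Gamma (α + i + 1) :=
  Real.Gamma_pos_of_pos (by linarith [(Nat.cast_nonneg i : (0 : ℝ) ≤ i)])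

theorem laguerreWeight_pos {α : ℝ} (hα : -1 < α) (n : ℕ) : 0 < laguerreWeight α n := by
  have := Gamma_shift_pos hα n
  rw [add_comm α] at this
  unfold laguerreWeight
  positivity

theorem laguerreWeight_succ {α : ℝ} (hα : -1 < α) (n : ℕ) :
    (n + 1) * laguerreWeight α (n + 1) = (n + α + 1) * laguerreWeight α n := by
  have h : (0 : ℝ) < n + α + 1 := by linarith [(Nat.cast_nonneg n : (0 : ℝ) ≤ n)]
  have hf : (n.factorial : ℝ) ≠ 0 := by positivity
  have hn : ((n : ℝ) + 1) ≠ 0 := by positivity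
  unfold laguerreWeight
  rw [Nat.factorial_succ]
  push_cast
  rw [show (n : ℝ) + 1 + α + 1 = (n + α + 1) + 1 by ring, Real.Gamma_add_one h.ne']
  field_simp

theorem laguerreWeight_add_one {α : ℝ} (hα : -1 < α) (n : ℕ) :
    laguerreWeight (α + 1) n = (n + α + 1) * laguerreWeight α n := by
  have h : (0 : ℝ) < n + α + 1 := by linarith [(Nat.cast_nonneg n : (0 : ℝ) ≤ n)]
  unfold laguerreWeight
  rw [show (n : ℝ) + (α + 1) + 1 = (n + α + 1) + 1 by ring, Real.Gamma_add_one h.ne']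
  ring

theorem laguerre_eq_lag (α : ℝ) (n : ℕ) (x : ℝ) :
    laguerre α n x = laguerreWeight α n * lag α n x := by
  unfold laguerre lag laguerreWeight
  rw [Finset.mul_sum]
  refine Finset.sum_congr rfl fun i hi => ?_
  have hin : i ≤ n := Nat.lt_succ_iff.mp (Finset.mem_range.mp hi)
  rw [Nat.cast_choose ℝ hin, neg_pow x]
  have hf : (n.factorial : ℝ) ≠ 0 := by positivity
  field_simp

theorem lag_eq_sum_range (α : ℝ) {n N : ℕ} (h : n < N) (x : ℝ) :
    lag α n x = ∑ i ∈ Finset.range N, (n.choose i : ℝ) * (-x) ^ i / Real.Gamma (α + i + 1) := by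
  unfold lag
  refine Finset.sum_subset (Finset.range_mono h) fun i _ hi => ?_
  rw [Nat.choose_eq_zero_of_lt (by simpa using hi)]
  simp

theorem lag_hasSum (α : ℝ) (n : ℕ) (x : ℝ) :
    HasSum (fun i : ℕ => (n.choose i : ℝ) * (-x) ^ i / Real.Gamma (α + i + 1)) (lag α n x) := by
  refine hasSum_sum_of_ne_finset_zero fun i hi => ?_
  rw [Nat.choose_eq_zero_of_lt (by simpa using hi)]
  simp

theorem continuous_lag (α : ℝ) (n : ℕ) : Continuous (lag α n) := by
  unfold lag
  fun_prop

/-- Pascal's rule, coefficient by coefficient. -/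
theorem mul_lag_add_one (α : ℝ) (n : ℕ) (x : ℝ) :
    x * lag (α + 1) n x = lag α n x - lag α (n + 1) x := by
  rw [lag_eq_sum_range α (show n < n + 2 by omega), lag_eq_sum_range α (show n + 1 < n + 2 by omega),
    ← Finset.sum_sub_distrib, Finset.sum_range_succ', lag, Finset.mul_sum]
  simp only [Nat.choose_zero_right, sub_self, add_zero]
  refine Finset.sum_congr rfl fun i _ => ?_
  rw [Nat.choose_succ_succ]
  push_cast
  rw [show α + 1 + (i : ℝ) + 1 = α + ((i : ℝ) + 1) + 1 by ring]
  ring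

/-- Coefficientwise this is (n+1) C(n,i) = (n+1-i) C(n+1,i), with Γ(α+i+2) = (α+i+1) Γ(α+i+1). -/
theorem lag_succ_eq {α : ℝ} (hα : -1 < α) (n : ℕ) (x : ℝ) :
    lag α (n + 1) x = (n + α + 2) * lag (α + 1) (n + 1) x - (n + 1) * lag (α + 1) n x := by
  rw [lag_eq_sum_range (α + 1) (show n < n + 2 by omega), lag, lag, Finset.mul_sum, Finset.mul_sum,
    ← Finset.sum_sub_distrib]
  refine Finset.sum_congr rfl fun i hi => ?_
  have hin : i ≤ n + 1 := Nat.lt_succ_iff.mp (Finset.mem_range.mp hi)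
  have h := congrArg (Nat.cast : ℕ → ℝ) (Nat.choose_mul_succ_eq n i)
  push_cast [Nat.cast_sub hin] at h
  have hG : Real.Gamma (α + 1 + i + 1) = (α + i + 1) * Real.Gamma (α + i + 1) := by
    rw [← Real.Gamma_add_one (by linarith [(Nat.cast_nonneg i : (0 : ℝ) ≤ i)])]
    ring_nf
  have h0 : α + i + 1 ≠ 0 := by linarith [(Nat.cast_nonneg i : (0 : ℝ) ≤ i)]
  have h1 := (Gamma_shift_pos hα i).ne'
  rw [hG]
  field_simp
  linear_combination (-x) ^ i * h

theorem lag_zero (α x : ℝ) : lag α 0 x = 1 / Real.Gamma (α + 1) := by simp [lag]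

theorem laguerreWeight_mul_lag_succ {α : ℝ} (hα : -1 < α) (n : ℕ) (x : ℝ) :
    (n + 2) * (laguerreWeight α (n + 2) * lag α (n + 2) x) =
      (2 * n + 3 + α - x) * (laguerreWeight α (n + 1) * lag α (n + 1) x) -
        (n + 1 + α) * (laguerreWeight α n * lag α n x) := by
  have h1 := mul_lag_add_one α (n + 1) x
  have h2 := mul_lag_add_one α n x
  have h3 := lag_succ_eq hα n x
  have w1 := laguerreWeight_succ hα (n + 1)
  have w2 := laguerreWeight_succ hα n
  push_cast at *
  have w1' : (n + 2) * laguerreWeight α (n + 2) = (n + α + 2) * laguerreWeight α (n + 1) := by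
    rw [show n + 2 = n + 1 + 1 by rfl]; linear_combination w1
  linear_combination lag α (n + 2) x * w1' + x * laguerreWeight α (n + 1) * h3
    + (n + α + 2) * laguerreWeight α (n + 1) * h1 - (n + 1) * laguerreWeight α (n + 1) * h2
    - lag α n x * w2

theorem laguerreWeight_mul_lag_zero {α : ℝ} (hα : -1 < α) (x : ℝ) :
    laguerreWeight α 0 * lag α 0 x = 1 := by
  have h1 := (Gamma_shift_pos hα 0).ne'
  simp only [Nat.cast_zero, add_zero] at h1
  simp [lag_zero, laguerreWeight, h1]

theorem laguerreWeight_mul_lag_one {α : ℝ} (hα : -1 < α) (x : ℝ) :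
    laguerreWeight α 1 * lag α 1 x = 1 + α - x := by
  have h1 := (Gamma_shift_pos hα 0).ne'
  have h2 : α + 1 ≠ 0 := by linarith
  simp only [Nat.cast_zero, add_zero] at h1
  simp only [lag, laguerreWeight, Finset.sum_range_succ, Finset.range_one, Finset.sum_singleton]
  simp only [Nat.cast_one, Nat.factorial_one, Nat.choose_zero_right, Nat.choose_self, Nat.cast_zero,
    pow_zero, pow_one, add_zero, one_mul, div_one]
  rw [show 1 + α + 1 = (α + 1) + 1 by ring, Real.Gamma_add_one h2]
  field_simp
  ring

/-- At -|x| all terms are nonnegative, so the right side serves as the majorant in every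
absolute-convergence argument below. -/
theorem abs_lag_le {α : ℝ} (hα : -1 < α) (n : ℕ) (x : ℝ) : |lag α n x| ≤ lag α n (-|x|) := by
  refine (Finset.abs_sum_le_sum_abs _ _).trans (le_of_eq (Finset.sum_congr rfl fun i _ => ?_))
  rw [abs_div, abs_mul, abs_pow, abs_neg, neg_neg, abs_of_pos (Gamma_shift_pos hα i), Nat.abs_cast]

theorem lag_neg_nonneg {α : ℝ} (hα : -1 < α) (n : ℕ) (x : ℝ) : 0 ≤ lag α n (-|x|) :=
  (abs_nonneg _).trans (abs_lag_le hα n x)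

/-! ### Generating functions -/

theorem _root_.HasSum.of_eq {f g : ℕ → ℝ} {a b : ℝ} (h : HasSum f a) (hfg : ∀ n, g n = f n)
    (hab : b = a) : HasSum g b := by
  rwa [funext hfg, hab]

theorem hasSum_of_hasSum_swap {f : ℕ × ℕ → ℝ} (hf : Summable f) {a b : ℕ → ℝ} {S : ℝ}
    (hrow : ∀ n, HasSum (fun j => f (n, j)) (a n)) (hcol : ∀ j, HasSum (fun n => f (n, j)) (b j))
    (hb : HasSum b S) : HasSum a S := by
  have h1 := hf.hasSum.prod_fiberwise hrow
  have h2 := ((Equiv.prodComm ℕ ℕ).hasSum_iff.mpr hf.hasSum).prod_fiberwise hcol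
  rwa [hb.unique h2]

theorem summable_of_abs_columns {f : ℕ × ℕ → ℝ} {b : ℕ → ℝ}
    (hcol : ∀ j, HasSum (fun n => |f (n, j)|) (b j)) (hb : Summable b) : Summable f := by
  refine Summable.of_abs ?_
  rw [← (Equiv.prodComm ℕ ℕ).summable_iff]
  refine (summable_prod_of_nonneg fun _ => abs_nonneg _).mpr
    ⟨fun j => (hcol j).summable, hb.congr fun j => ((hcol j).tsum_eq).symm⟩

theorem summable_of_abs_rows {f : ℕ × ℕ → ℝ} {b : ℕ → ℝ}
    (hrow : ∀ n, HasSum (fun j => |f (n, j)|) (b n)) (hb : Summable b) : Summable f :=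
  Summable.of_abs ((summable_prod_of_nonneg fun _ => abs_nonneg _).mpr
    ⟨fun j => (hrow j).summable, hb.congr fun j => ((hrow j).tsum_eq).symm⟩)

theorem ascPochhammer_mul_Gamma {c : ℝ} (hc : 0 < c) (p : ℕ) :
    (ascPochhammer ℝ p).eval c * Real.Gamma c = Real.Gamma (p + c) := by
  induction p with
  | zero => simp
  | succ p ih =>
    rw [ascPochhammer_succ_eval, mul_right_comm, ih]
    push_cast
    rw [show (p : ℝ) + 1 + c = (p + c) + 1 by ring,
      Real.Gamma_add_one (by positivity)]
    ring

theorem hasSum_Gamma_binomial {c w : ℝ} (hc : 0 < c) (hw0 : 0 ≤ w) (hw : w < 1) :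
    HasSum (fun p : ℕ => Real.Gamma (p + c) / (Real.Gamma c * p.factorial) * w ^ p)
      ((1 - w) ^ (-c)) := by
  have h := (Real.one_div_one_sub_rpow_hasFPowerSeriesOnBall_zero c).hasSum (y := w)
    (by simpa [enorm_eq_nnnorm, ← NNReal.coe_lt_coe, abs_of_nonneg hw0] using hw)
  rw [zero_add, one_div, ← Real.rpow_neg (by linarith)] at h
  refine h.of_eq (fun p => ?_) rfl
  have h2 := Ring.descPochhammer_eq_factorial_smul_choose (c + p - 1) p
  rw [Polynomial.descPochhammer_smeval_eq_ascPochhammer, nsmul_eq_mul,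
    Polynomial.ascPochhammer_smeval_eq_eval, show c + p - 1 - p + 1 = c by ring] at h2
  simp only [FormalMultilinearSeries.ofScalars_apply_eq, smul_eq_mul]
  have hG := (Real.Gamma_pos_of_pos hc).ne'
  rw [← ascPochhammer_mul_Gamma hc, h2]
  field_simp

theorem hasSum_exp (x : ℝ) : HasSum (fun n : ℕ => x ^ n / n.factorial) (Real.exp x) := by
  rw [Real.exp_eq_exp_ℝ]
  exact NormedSpace.expSeries_div_hasSum_exp x

/-- With n = p + i this is the binomial series of (1-w)^(-(α+i+1)); the terms with n < i vanish. -/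
theorem hasSum_laguerre_column {α w : ℝ} (hα : -1 < α) (hw0 : 0 ≤ w) (hw : w < 1) (x : ℝ) (i : ℕ) :
    HasSum (fun n : ℕ => w ^ n * laguerreWeight α n *
        ((n.choose i : ℝ) * x ^ i / Real.Gamma (α + i + 1)))
      ((1 - w) ^ (-(α + 1)) * ((x * w / (1 - w)) ^ i / i.factorial)) := by
  have hi := Gamma_shift_pos hα i
  have h := (hasSum_Gamma_binomial (c := α + i + 1)
    (by linarith [(Nat.cast_nonneg i : (0 : ℝ) ≤ i)]) hw0 hw).mul_left ((x * w) ^ i / i.factorial)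
  have hinj : Function.Injective fun p : ℕ => p + i := add_left_injective i
  rw [← hinj.hasSum_iff]
  · refine h.of_eq (fun p => ?_) ?_
    · have := Nat.cast_choose ℝ (show i ≤ p + i by omega)
      simp only [Function.comp_apply, laguerreWeight, this, Nat.add_sub_cancel]
      push_cast
      rw [show (p : ℝ) + i + α + 1 = p + (α + i + 1) by ring, pow_add, mul_pow]
      have hp : ((p + i).factorial : ℝ) ≠ 0 := by positivity
      field_simp
    · rw [show -(α + i + 1) = -(α + 1) - i by ring, Real.rpow_sub (by linarith), Real.rpow_natCast,
        div_pow]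
      ring
  · intro n hn
    have : n < i := by
      by_contra hc
      exact hn ⟨n - i, by simp; omega⟩
    simp [Nat.choose_eq_zero_of_lt this]

/-- The generating function of the Laguerre polynomials. -/
theorem hasSum_laguerre {α w : ℝ} (hα : -1 < α) (hw0 : 0 ≤ w) (hw : w < 1) (x : ℝ) :
    HasSum (fun n : ℕ => w ^ n * laguerreWeight α n * lag α n x)
      ((1 - w) ^ (-(α + 1)) * Real.exp (-x * w / (1 - w))) := by
  refine hasSum_of_hasSum_swap (f := fun p => w ^ p.1 * laguerreWeight α p.1 *
    ((p.1.choose p.2 : ℝ) * (-x) ^ p.2 / Real.Gamma (α + p.2 + 1))) ?_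
    (fun n => (lag_hasSum α n x).mul_left _) (hasSum_laguerre_column hα hw0 hw (-x))
    ((hasSum_exp _).mul_left _)
  refine summable_of_abs_columns (b := fun i =>
    (1 - w) ^ (-(α + 1)) * ((|x| * w / (1 - w)) ^ i / i.factorial)) (fun i => ?_)
    ((hasSum_exp _).summable.mul_left _)
  refine (hasSum_laguerre_column hα hw0 hw |x| i).of_eq (fun n => ?_) rfl
  rw [abs_mul, abs_mul, abs_div, abs_mul, abs_pow, abs_pow, abs_neg, abs_of_nonneg hw0,
    abs_of_pos (Gamma_shift_pos hα i), abs_of_pos (laguerreWeight_pos hα n), Nat.abs_cast]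

/-- A term of a convergent nonnegative series is at most its sum, so the generating function already
gives growth slower than any r^(-n) with r < 1. -/
theorem laguerre_growth {α r : ℝ} (hα : -1 < α) (hr0 : 0 ≤ r) (hr : r < 1) (x : ℝ) :
    ∃ C, 0 ≤ C ∧ ∀ n : ℕ, r ^ n * laguerreWeight α n * lag α n (-|x|) ≤ C := by
  have h0 : ∀ n : ℕ, 0 ≤ r ^ n * laguerreWeight α n * lag α n (-|x|) := fun n =>
    mul_nonneg (mul_nonneg (pow_nonneg hr0 n) (laguerreWeight_pos hα n).le) (lag_neg_nonneg hα n x)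
  have h := hasSum_laguerre hα hr0 hr (-|x|)
  exact ⟨_, (h0 0).trans (le_hasSum h 0 fun n _ => h0 n), fun n => le_hasSum h n fun n _ => h0 n⟩

/-- Write w = √w·√w: one factor absorbs the polynomial weight, the other the growth of the Laguerre
polynomials. -/
theorem summable_choose_laguerre {α w : ℝ} (hα : -1 < α) (hw0 : 0 ≤ w) (hw : w < 1) (x : ℝ)
    (j : ℕ) : Summable fun n : ℕ => (n.choose j : ℝ) * (w ^ n * laguerreWeight α n * lag α n x) := by
  have hr : √w < 1 := by rw [Real.sqrt_lt' one_pos]; simpa using hw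
  obtain ⟨C, hC0, hC⟩ := laguerre_growth hα (Real.sqrt_nonneg w) hr x
  have hs := (summable_pow_mul_geometric_of_norm_lt_one j
    (r := √w) (by simpa [abs_of_nonneg] using hr)).mul_right C
  refine Summable.of_norm_bounded hs fun n => ?_
  have hW := (laguerreWeight_pos hα n).le
  have hch : (n.choose j : ℝ) ≤ n ^ j := by exact_mod_cast Nat.choose_le_pow n j
  calc ‖(n.choose j : ℝ) * (w ^ n * laguerreWeight α n * lag α n x)‖
      = n.choose j * (w ^ n * laguerreWeight α n * |lag α n x|) := by
        rw [Real.norm_eq_abs, abs_mul, abs_mul, abs_mul, abs_pow, abs_of_nonneg hw0,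
          abs_of_nonneg hW, Nat.abs_cast]
    _ ≤ n ^ j * (w ^ n * laguerreWeight α n * lag α n (-|x|)) := by
        gcongr
        exact abs_lag_le hα n x
    _ = n ^ j * √w ^ n * (√w ^ n * laguerreWeight α n * lag α n (-|x|)) := by
        nth_rewrite 1 [← Real.mul_self_sqrt hw0]
        rw [mul_pow]; ring
    _ ≤ n ^ j * √w ^ n * C := by
        gcongr
        exact hC n

/-! ### Generating functions with binomial weights. -/

/-- The `j`-th normalized derivative, times `w ^ j`, of the generating function. -/
def laguerreGen (α x w : ℝ) (j : ℕ) : ℝ :=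
  ∑' n : ℕ, (n.choose j : ℝ) * (w ^ n * laguerreWeight α n * lag α n x)

/-- Turns multiplication by n into a shift of j, so that a recurrence in n becomes a recurrence in j
after summation. -/
theorem mul_choose (n j : ℕ) :
    (n : ℝ) * n.choose j = (j + 1) * n.choose (j + 1) + j * n.choose j := by
  rcases lt_or_ge n j with h | h
  · simp [Nat.choose_eq_zero_of_lt h, Nat.choose_eq_zero_of_lt (h.trans (Nat.lt_succ_self j))]
  · have := congrArg (Nat.cast : ℕ → ℝ) (Nat.choose_succ_right_eq n j)
    push_cast [Nat.cast_sub h] at this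
    linear_combination -this

/-- The Laguerre recurrence multiplied by C(n+1,j) w^(n+2) and summed over n. The last term is left
as F because C(n+1,j) expands differently for j = 0 and j > 0. -/
theorem hasSum_laguerre_shift {α w : ℝ} (hα : -1 < α) (hw0 : 0 ≤ w) (hw : w < 1) (x : ℝ) (j : ℕ)
    {F : ℝ} (hF : HasSum (fun n : ℕ => (((n + 1 : ℕ).choose j : ℝ) * (n + 1 + α)) *
      (w ^ n * laguerreWeight α n * lag α n x)) F) :
    (j + 1) * laguerreGen α x w (j + 1) - w * (2 * ((j + 1) * laguerreGen α x w (j + 1)) +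
      (2 * j + 1 + α - x) * laguerreGen α x w j) = - w ^ 2 * F := by
  set a : ℕ → ℝ := fun n => w ^ n * laguerreWeight α n * lag α n x with ha
  have hG : ∀ j, HasSum (fun n : ℕ => (n.choose j : ℝ) * a n) (laguerreGen α x w j) := fun j =>
    (summable_choose_laguerre hα hw0 hw x j).hasSum
  have h1 : HasSum (fun n : ℕ => (n.choose j : ℝ) * (n + 1) * a (n + 1))
      ((j + 1) * laguerreGen α x w (j + 1)) := by
    have := (hasSum_nat_add_iff' 1).mpr ((hG (j + 1)).mul_left ((j : ℝ) + 1))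
    refine this.of_eq (fun n => ?_) (by simp)
    have := congrArg (Nat.cast : ℕ → ℝ) (Nat.add_one_mul_choose_eq n j)
    push_cast at this
    linear_combination a (n + 1) * this
  have h2 : HasSum (fun n : ℕ => (n.choose j : ℝ) * (n + 1) * a (n + 1) -
        w * ((n.choose j : ℝ) * (2 * n + 1 + α - x) * a n))
      ((j + 1) * laguerreGen α x w (j + 1) - w * (2 * ((j + 1) * laguerreGen α x w (j + 1)) +
      (2 * j + 1 + α - x) * laguerreGen α x w j)) := by
    refine h1.sub (HasSum.mul_left w ?_)
    refine (((hG (j + 1)).mul_left (2 * ((j : ℝ) + 1))).add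
      ((hG j).mul_left (2 * (j : ℝ) + 1 + α - x))).of_eq (fun n => ?_) (by ring)
    linear_combination 2 * a n * mul_choose n j
  -- The discarded term n = 0 is zero, since L_1 = (1+α-x) L_0.
  have h3 := (hasSum_nat_add_iff' 1).mpr h2
  refine (h3.of_eq (b := _) (fun n => ?_) ?_).unique (hF.mul_left (-w ^ 2))
  · have := laguerreWeight_mul_lag_succ hα n x
    simp only [ha]
    push_cast
    rw [show n + 1 + 1 = n + 2 by rfl, pow_succ, pow_succ]
    linear_combination (-w ^ n * w ^ 2 * ((n + 1).choose j)) * this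
  · have e0 := laguerreWeight_mul_lag_zero hα x
    have e1 := laguerreWeight_mul_lag_one hα x
    simp only [Finset.range_one, Finset.sum_singleton, ha, Nat.cast_zero, pow_zero, pow_one, zero_add]
    linear_combination ((Nat.choose 0 j : ℝ) * w) * e1 - (Nat.choose 0 j : ℝ) * w * (1 + α - x) * e0

theorem laguerreGen_one {α w : ℝ} (hα : -1 < α) (hw0 : 0 ≤ w) (hw : w < 1) (x : ℝ) :
    (1 - w) ^ 2 * laguerreGen α x w 1 = w * ((1 + α) * (1 - w) - x) * laguerreGen α x w 0 := by
  have hG : ∀ j, HasSum (fun n : ℕ => (n.choose j : ℝ) * _) (laguerreGen α x w j) := fun j =>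
    (summable_choose_laguerre hα hw0 hw x j).hasSum
  have h := hasSum_laguerre_shift hα hw0 hw x 0 (F := laguerreGen α x w 1 +
    (1 + α) * laguerreGen α x w 0) (((hG 1).add ((hG 0).mul_left (1 + α))).of_eq (fun n => by
      simp only [Nat.choose_zero_right, Nat.choose_one_right]; push_cast; ring) rfl)
  push_cast at h
  linear_combination h

theorem laguerreGen_succ {α w : ℝ} (hα : -1 < α) (hw0 : 0 ≤ w) (hw : w < 1) (x : ℝ) (j : ℕ) :
    (1 - w) ^ 2 * ((j + 2) * laguerreGen α x w (j + 2)) =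
      w * ((2 * j + 3 + α) * (1 - w) - x) * laguerreGen α x w (j + 1) -
        w ^ 2 * (j + 1 + α) * laguerreGen α x w j := by
  have hG : ∀ j, HasSum (fun n : ℕ => (n.choose j : ℝ) * _) (laguerreGen α x w j) := fun j =>
    (summable_choose_laguerre hα hw0 hw x j).hasSum
  have h := hasSum_laguerre_shift hα hw0 hw x (j + 1) (F := (j + 2) * laguerreGen α x w (j + 2) +
    (2 * j + 3 + α) * laguerreGen α x w (j + 1) + (j + 1 + α) * laguerreGen α x w j)
    ((((hG (j + 2)).mul_left ((j : ℝ) + 2)).add ((hG (j + 1)).mul_left (2 * (j : ℝ) + 3 + α))).add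
      ((hG j).mul_left ((j : ℝ) + 1 + α)) |>.of_eq (fun n => by
      have e1 := mul_choose n (j + 1)
      have e0 := mul_choose n j
      have e2 := congrArg (Nat.cast : ℕ → ℝ) (Nat.choose_succ_succ n j)
      push_cast at e1 e2 ⊢
      rw [Nat.succ_eq_add_one, Nat.succ_eq_add_one, show j + 1 + 1 = j + 2 by rfl] at *
      rw [e2]
      linear_combination (w ^ n * laguerreWeight α n * lag α n x) * (e1 + e0)) rfl)
  push_cast at h
  rw [show j + 1 + 1 = j + 2 by rfl] at h
  linear_combination h

/-- The recurrence in j is again the Laguerre recurrence, now at x/(1-w) and rescaled by w/(1-w), so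
two initial values determine everything. -/
theorem laguerreGen_eq {α w : ℝ} (hα : -1 < α) (hw0 : 0 ≤ w) (hw : w < 1) (x : ℝ) (j : ℕ) :
    laguerreGen α x w j = (1 - w) ^ (-(α + 1)) * Real.exp (-x * w / (1 - w)) *
      ((w / (1 - w)) ^ j * (laguerreWeight α j * lag α j (x / (1 - w)))) := by
  have hw1 : 1 - w ≠ 0 := by linarith
  have h0 : laguerreGen α x w 0 = (1 - w) ^ (-(α + 1)) * Real.exp (-x * w / (1 - w)) := by
    simpa [laguerreGen] using (hasSum_laguerre hα hw0 hw x).tsum_eq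
  induction j using Nat.twoStepInduction with
  | zero => rw [h0, laguerreWeight_mul_lag_zero hα]; simp
  | one =>
    have h := laguerreGen_one hα hw0 hw x
    rw [h0] at h
    rw [laguerreWeight_mul_lag_one hα]
    refine mul_left_cancel₀ (pow_ne_zero 2 hw1) (h.trans ?_)
    field_simp
  | more j ih0 ih1 =>
    have h := laguerreGen_succ hα hw0 hw x j
    rw [ih0, ih1] at h
    have hr := laguerreWeight_mul_lag_succ hα j (x / (1 - w))
    have hj : (j : ℝ) + 2 ≠ 0 := by positivity
    rw [← mul_assoc] at h
    refine mul_left_cancel₀ (mul_ne_zero (pow_ne_zero 2 hw1) hj) (h.trans ?_)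
    have hr' : laguerreWeight α (j + 2) * lag α (j + 2) (x / (1 - w)) =
      ((2 * j + 3 + α - x / (1 - w)) * (laguerreWeight α (j + 1) * lag α (j + 1) (x / (1 - w))) -
        (j + 1 + α) * (laguerreWeight α j * lag α j (x / (1 - w)))) / (j + 2) := by
      rw [eq_div_iff hj]; linear_combination hr
    rw [hr']
    generalize laguerreWeight α (j + 1) * lag α (j + 1) (x / (1 - w)) = p
    generalize laguerreWeight α j * lag α j (x / (1 - w)) = q
    rw [pow_add _ j 1, pow_add _ j 2]
    generalize (w / (1 - w)) ^ j = r
    field_simp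

/-! ### The entire function behind the modified Bessel functions, and the Hille-Hardy formula -/

/-- (n+1) W_n is nondecreasing because (n+2)(n+α+1) ≥ (n+1)^2; at n = 0 this is precisely α ≥ -1/2.
-/
theorem Gamma_le_mul_laguerreWeight {α : ℝ} (hα : -(1 / 2) ≤ α) (n : ℕ) :
    Real.Gamma (α + 1) ≤ (n + 1) * laguerreWeight α n := by
  have hα' : -1 < α := by linarith
  induction n with
  | zero => simp [laguerreWeight]
  | succ n ih =>
    refine ih.trans ?_
    have h := laguerreWeight_succ hα' n
    have hn : (0 : ℝ) ≤ n := Nat.cast_nonneg n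
    have hW := laguerreWeight_pos hα' n
    push_cast
    have h2 : ((n : ℝ) + 1 + 1) * laguerreWeight α (n + 1) =
        ((n + 2) * (n + α + 1) / (n + 1)) * laguerreWeight α n := by
      field_simp
      linear_combination (n + 2 : ℝ) * h
    rw [h2]
    refine mul_le_mul_of_nonneg_right ?_ hW.le
    rw [le_div_iff₀ (by positivity)]
    nlinarith

/-- Lets the exponential series dominate `besselSeries`. The 2 comes from n + 1 ≤ 2 n!. -/
theorem inv_Gamma_le {α : ℝ} (hα : -(1 / 2) ≤ α) (n : ℕ) :
    (Real.Gamma (α + n + 1))⁻¹ ≤ 2 / Real.Gamma (α + 1) := by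
  have hα' : -1 < α := by linarith
  have h := Gamma_le_mul_laguerreWeight hα n
  have h1 : ((n : ℝ) + 1) ≤ 2 * n.factorial := by
    have h2 := Nat.self_le_factorial n
    have h3 := Nat.factorial_pos n
    exact_mod_cast (by omega : n + 1 ≤ 2 * n.factorial)
  have hG : 0 < Real.Gamma (α + 1) := by simpa using Gamma_shift_pos hα' 0
  have hW := laguerreWeight_pos hα' n
  have h4 : Real.Gamma (α + n + 1) = n.factorial * laguerreWeight α n := by
    rw [laguerreWeight, add_comm α]; field_simp
  rw [inv_le_comm₀ (Gamma_shift_pos hα' n) (by positivity), inv_div, div_le_iff₀ two_pos, h4]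
  nlinarith

/-- `∑ u^j / (j! Γ(α+j+1))`, so that `I_α(z) = (z/2)^α besselSeries α (z²/4)`. -/
def besselSeries (α u : ℝ) : ℝ := ∑' j : ℕ, u ^ j / (j.factorial * Real.Gamma (α + j + 1))

theorem summable_besselSeries {α : ℝ} (hα : -(1 / 2) ≤ α) (u : ℝ) :
    Summable fun j : ℕ => u ^ j / (j.factorial * Real.Gamma (α + j + 1)) := by
  refine Summable.of_norm_bounded ((hasSum_exp |u|).summable.mul_right (2 / Real.Gamma (α + 1)))
    fun n => ?_
  have hG := Gamma_shift_pos (show -1 < α by linarith) n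
  rw [norm_div, norm_pow, norm_mul, Real.norm_eq_abs, Real.norm_of_nonneg hG.le,
    Real.norm_of_nonneg (by positivity), ← div_div, div_eq_mul_inv _ (Real.Gamma _)]
  exact mul_le_mul_of_nonneg_left (inv_Gamma_le hα n) (by positivity)

theorem hasSum_besselSeries {α : ℝ} (hα : -(1 / 2) ≤ α) (u : ℝ) :
    HasSum (fun j : ℕ => u ^ j / (j.factorial * Real.Gamma (α + j + 1))) (besselSeries α u) :=
  (summable_besselSeries hα u).hasSum

theorem besselSeries_pos {α u : ℝ} (hα : -(1 / 2) ≤ α) (hu : 0 ≤ u) : 0 < besselSeries α u := by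
  have hG := fun n : ℕ => Gamma_shift_pos (show -1 < α by linarith) n
  refine (summable_besselSeries hα u).tsum_pos (fun n => ?_) 0 ?_
  · have := hG n
    positivity
  · have := hG 0
    simp only [pow_zero, Nat.factorial_zero]
    positivity

theorem hasDerivAt_besselSeries {α : ℝ} (hα : -(1 / 2) ≤ α) (u : ℝ) :
    HasDerivAt (besselSeries α) (besselSeries (α + 1) u) u := by
  have hG := fun n : ℕ => Gamma_shift_pos (show -1 < α by linarith) n
  have hα1 : -(1 / 2) ≤ α + 1 := by linarith
  set R := |u| + 1 with hR
  have hR0 : 0 ≤ R := by positivity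
  -- At j = 0 the truncated exponent is harmless: the factor j makes the term zero.
  set g' : ℕ → ℝ → ℝ := fun j y => (j * y ^ (j - 1)) / (j.factorial * Real.Gamma (α + j + 1))
  have hg' : ∀ (j : ℕ) y, g' (j + 1) y = y ^ j / (j.factorial * Real.Gamma (α + 1 + j + 1)) := by
    intro j y
    simp only [g', Nat.factorial_succ, Nat.add_sub_cancel]
    push_cast
    rw [show α + ((j : ℝ) + 1) + 1 = α + 1 + j + 1 by ring]
    have : (j : ℝ) + 1 ≠ 0 := by positivity
    field_simp
  have hs : Summable fun j => g' j R := by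
    rw [← summable_nat_add_iff 1]
    exact (summable_besselSeries hα1 R).congr fun j => (hg' j R).symm
  have h := hasDerivAt_tsum_of_isPreconnected (𝕜 := ℝ) (t := Metric.ball 0 R) (y₀ := u) (y := u)
    (g := fun (j : ℕ) y => y ^ j / (j.factorial * Real.Gamma (α + j + 1))) (g' := g') hs
    Metric.isOpen_ball (convex_ball _ _).isPreconnected
    (fun n y _ => (hasDerivAt_pow n y).div_const _) (fun n y hy => ?_)
    (by simp [hR]) (summable_besselSeries hα u) (by simp [hR])
  · have he : ∑' n, g' n u = besselSeries (α + 1) u := by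
      refine HasSum.tsum_eq ?_
      rw [← hasSum_nat_add_iff' 1]
      exact (hasSum_besselSeries hα1 u).of_eq (fun j => hg' j u) (by simp [g'])
    rw [he] at h
    exact h
  · have hy' : |y| ≤ R := by simpa using (mem_ball_zero_iff.mp hy).le
    have := hG n
    simp only [g', norm_div, norm_mul, norm_pow, Real.norm_eq_abs, Nat.abs_cast, abs_of_pos (hG n)]
    gcongr

theorem continuous_besselSeries {α : ℝ} (hα : -(1 / 2) ≤ α) : Continuous (besselSeries α) :=
  continuous_iff_continuousAt.mpr fun u => (hasDerivAt_besselSeries hα u).continuousAt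

/-- The three-term relation of the modified Bessel functions: split α + j + 1 in Γ(α+j+2) = (α+j+1)
Γ(α+j+1) as (α+1) + j. -/
theorem besselSeries_contiguous {α : ℝ} (hα : -(1 / 2) ≤ α) (u : ℝ) :
    besselSeries α u = (α + 1) * besselSeries (α + 1) u + u * besselSeries (α + 2) u := by
  have h1 := hasSum_besselSeries (show -(1 / 2) ≤ α + 1 by linarith) u
  have h2 := (hasSum_besselSeries (show -(1 / 2) ≤ α + 2 by linarith) u).mul_left u
  have h3 : HasSum (fun j : ℕ => j * (u ^ j / (j.factorial * Real.Gamma (α + 1 + j + 1))))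
      (u * besselSeries (α + 2) u) := by
    rw [← hasSum_nat_add_iff' 1]
    refine h2.of_eq (fun j => ?_) (by simp)
    rw [Nat.factorial_succ]
    push_cast
    rw [show α + 1 + ((j : ℝ) + 1) + 1 = α + 2 + j + 1 by ring, pow_succ]
    have : (j : ℝ) + 1 ≠ 0 := by positivity
    field_simp
  refine (hasSum_besselSeries hα u).unique (((h1.mul_left (α + 1)).add h3).of_eq (fun j => ?_) rfl)
  have h0 : (0 : ℝ) < α + j + 1 := by linarith [(Nat.cast_nonneg j : (0 : ℝ) ≤ j)]
  rw [show α + 1 + (j : ℝ) + 1 = (α + j + 1) + 1 by ring, Real.Gamma_add_one h0.ne']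
  have := (Gamma_shift_pos (show -1 < α by linarith) j).ne'
  field_simp
  ring

theorem hasSum_exp_lag_column (α v x : ℝ) (i : ℕ) :
    HasSum (fun j : ℕ => v ^ j / j.factorial * ((j.choose i : ℝ) * x ^ i / Real.Gamma (α + i + 1)))
      (Real.exp v * ((x * v) ^ i / (i.factorial * Real.Gamma (α + i + 1)))) := by
  have h := (hasSum_exp v).mul_right ((x * v) ^ i / (i.factorial * Real.Gamma (α + i + 1)))
  have hinj : Function.Injective fun p : ℕ => p + i := add_left_injective i
  rw [← hinj.hasSum_iff]
  · refine h.of_eq (fun p => ?_) rfl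
    have := Nat.cast_choose ℝ (show i ≤ p + i by omega)
    simp only [Function.comp_apply, this, Nat.add_sub_cancel]
    rw [pow_add, mul_pow]
    have hp : ((p + i).factorial : ℝ) ≠ 0 := by positivity
    field_simp
  · intro n hn
    have : n < i := by
      by_contra hc
      exact hn ⟨n - i, by simp; omega⟩
    simp [Nat.choose_eq_zero_of_lt this]

/-- The exponential generating function; in the Hille-Hardy formula it performs the sum over j. -/
theorem hasSum_exp_lag {α : ℝ} (hα : -(1 / 2) ≤ α) (v x : ℝ) :
    HasSum (fun j : ℕ => v ^ j / j.factorial * lag α j x)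
      (Real.exp v * besselSeries α (-x * v)) := by
  refine hasSum_of_hasSum_swap (f := fun p => v ^ p.1 / p.1.factorial *
    ((p.1.choose p.2 : ℝ) * (-x) ^ p.2 / Real.Gamma (α + p.2 + 1))) ?_
    (fun n => (lag_hasSum α n x).mul_left _) (hasSum_exp_lag_column α v (-x))
    ((hasSum_besselSeries hα _).mul_left _)
  refine summable_of_abs_columns (b := fun i => Real.exp |v| *
    ((|x| * |v|) ^ i / (i.factorial * Real.Gamma (α + i + 1)))) (fun i => ?_)
    ((hasSum_besselSeries hα _).summable.mul_left _)
  refine (hasSum_exp_lag_column α |v| |x| i).of_eq (fun n => ?_) rfl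
  rw [abs_mul, abs_div, abs_div, abs_mul, abs_pow, abs_pow, abs_neg,
    abs_of_pos (Gamma_shift_pos (show -1 < α by linarith) i), Nat.abs_cast, Nat.abs_cast]

/-- `laguerre_growth` needs one weight per polynomial but only one is present; the second is
inserted at the price of n + 1. Splitting w into √w, √√w, √√w pays for the two growths and for n +
1. -/
theorem summable_laguerre_mul_lag {α w : ℝ} (hα : -(1 / 2) ≤ α) (hw0 : 0 ≤ w) (hw : w < 1)
    (x y : ℝ) :
    Summable fun n : ℕ => w ^ n * laguerreWeight α n * lag α n (-|x|) * lag α n (-|y|) := by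
  have hα' : -1 < α := by linarith
  have hG : 0 < Real.Gamma (α + 1) := by simpa using Gamma_shift_pos hα' 0
  have hr : √w < 1 := by rw [Real.sqrt_lt' one_pos]; simpa using hw
  have hr' : √√w < 1 := by rw [Real.sqrt_lt' one_pos]; simpa using hr
  obtain ⟨C, hC0, hC⟩ := laguerre_growth hα' (Real.sqrt_nonneg w) hr x
  obtain ⟨D, hD0, hD⟩ := laguerre_growth hα' (Real.sqrt_nonneg √w) hr' y
  have hs : Summable fun n : ℕ => C * D / Real.Gamma (α + 1) * ((n + 1) * √√w ^ n) := by
    have h1 := summable_pow_mul_geometric_of_norm_lt_one 1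
      (r := √√w) (by simpa [abs_of_nonneg] using hr')
    have h0 := summable_geometric_of_lt_one (Real.sqrt_nonneg √w) hr'
    exact ((h1.add h0).congr fun n => by simp only [pow_one]; ring).mul_left _
  refine Summable.of_nonneg_of_le (fun n => ?_) (fun n => ?_) hs
  · exact mul_nonneg (mul_nonneg (mul_nonneg (pow_nonneg hw0 n) (laguerreWeight_pos hα' n).le)
      (lag_neg_nonneg hα' n x)) (lag_neg_nonneg hα' n y)
  · have hW := laguerreWeight_pos hα' n
    have h1 : 1 ≤ (n + 1) * laguerreWeight α n / Real.Gamma (α + 1) := by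
      rw [one_le_div hG]; exact Gamma_le_mul_laguerreWeight hα n
    have hx := lag_neg_nonneg hα' n x
    have hy := lag_neg_nonneg hα' n y
    calc w ^ n * laguerreWeight α n * lag α n (-|x|) * lag α n (-|y|)
        = w ^ n * laguerreWeight α n * lag α n (-|x|) * lag α n (-|y|) * 1 := by ring
      _ ≤ w ^ n * laguerreWeight α n * lag α n (-|x|) * lag α n (-|y|) *
          ((n + 1) * laguerreWeight α n / Real.Gamma (α + 1)) := by gcongr
      _ = (√w ^ n * laguerreWeight α n * lag α n (-|x|)) *
          (√√w ^ n * laguerreWeight α n * lag α n (-|y|)) * ((n + 1) * √√w ^ n) /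
            Real.Gamma (α + 1) := by
          nth_rewrite 1 [← Real.mul_self_sqrt hw0]
          rw [mul_pow]
          nth_rewrite 2 [← Real.mul_self_sqrt (Real.sqrt_nonneg w)]
          rw [mul_pow]
          ring
      _ ≤ C * D * ((n + 1) * √√w ^ n) / Real.Gamma (α + 1) := by
          gcongr
          · exact hC n
          · exact hD n
      _ = _ := by ring

/-- The Hille-Hardy formula. -/
theorem hasSum_hilleHardy {α w : ℝ} (hα : -(1 / 2) ≤ α) (hw0 : 0 ≤ w) (hw : w < 1) (x y : ℝ) :
    HasSum (fun n : ℕ => w ^ n * laguerreWeight α n * lag α n x * lag α n y)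
      ((1 - w) ^ (-(α + 1)) * Real.exp (-(x + y) * w / (1 - w)) *
        besselSeries α (x * y * w / (1 - w) ^ 2)) := by
  have hα' : -1 < α := by linarith
  have hw1 : 1 - w ≠ 0 := by linarith
  -- Expanding only the polynomial in y makes the columns `laguerreGen`, whose closed form leaves an
  -- exponential generating function at x/(1-w).
  refine hasSum_of_hasSum_swap (f := fun p => w ^ p.1 * laguerreWeight α p.1 * lag α p.1 x *
    ((p.1.choose p.2 : ℝ) * (-y) ^ p.2 / Real.Gamma (α + p.2 + 1))) ?_
    (b := fun j => laguerreGen α x w j * ((-y) ^ j / Real.Gamma (α + j + 1)))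
    (fun n => (lag_hasSum α n y).mul_left _) (fun j => ?_) ?_
  · refine summable_of_abs_rows (b := fun n => w ^ n * laguerreWeight α n * |lag α n x| *
      lag α n (-|y|)) (fun n => ?_) ?_
    · refine ((lag_hasSum α n (-|y|)).mul_left _).of_eq (fun j => ?_) rfl
      rw [abs_mul, abs_mul, abs_mul, abs_div, abs_mul, abs_pow, abs_pow, abs_neg, neg_neg,
        abs_of_pos (Gamma_shift_pos hα' j), Nat.abs_cast, abs_of_nonneg hw0,
        abs_of_pos (laguerreWeight_pos hα' n)]
    · refine Summable.of_nonneg_of_le (fun n => ?_) (fun n => ?_)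
        (summable_laguerre_mul_lag hα hw0 hw x y)
      · have := (laguerreWeight_pos hα' n).le
        have := lag_neg_nonneg hα' n y
        positivity
      · have := (laguerreWeight_pos hα' n).le
        have := lag_neg_nonneg hα' n y
        gcongr
        exact abs_lag_le hα' n x
  · refine ((summable_choose_laguerre hα' hw0 hw x j).hasSum.mul_right
      ((-y) ^ j / Real.Gamma (α + j + 1))).of_eq (fun n => ?_) rfl
    ring
  · have h := ((hasSum_exp_lag hα (-y * w / (1 - w)) (x / (1 - w))).mul_left
      ((1 - w) ^ (-(α + 1)) * Real.exp (-x * w / (1 - w))))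
    refine h.of_eq (fun j => ?_) ?_
    · rw [laguerreGen_eq hα' hw0 hw, laguerreWeight, add_comm (j : ℝ) α]
      have := Gamma_shift_pos hα' j
      rw [mul_div_assoc (-y) w, mul_pow (-y)]
      field_simp
    · rw [show -(x + y) * w / (1 - w) = -x * w / (1 - w) + -y * w / (1 - w) by ring, Real.exp_add,
        show -(x / (1 - w)) * (-y * w / (1 - w)) = x * y * w / (1 - w) ^ 2 by field_simp]
      ring

/-! ### Even and odd parts of the Dunkl kernel -/

/-- Even part of the (unnormalized) one-dimensional Dunkl kernel, in the variable `2z`. -/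
def dunklEven (k : ℝ≥0) (z : ℝ) : ℝ := besselSeries ((k : ℝ) - 1 / 2) (z ^ 2)

/-- Odd part of the (unnormalized) one-dimensional Dunkl kernel, in the variable `2z`. -/
def dunklOdd (k : ℝ≥0) (z : ℝ) : ℝ := z * besselSeries ((k : ℝ) + 1 / 2) (z ^ 2)

theorem neg_half_le_sub (k : ℝ≥0) : -(1 / 2) ≤ (k : ℝ) - 1 / 2 := by
  linarith [k.coe_nonneg]

theorem neg_half_le_add (k : ℝ≥0) : -(1 / 2) ≤ (k : ℝ) + 1 / 2 := by
  linarith [k.coe_nonneg]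

theorem continuous_dunklEven (k : ℝ≥0) : Continuous (dunklEven k) :=
  (continuous_besselSeries (neg_half_le_sub k)).comp (by fun_prop)

theorem continuous_dunklOdd (k : ℝ≥0) : Continuous (dunklOdd k) :=
  continuous_id.mul ((continuous_besselSeries (neg_half_le_add k)).comp (by fun_prop))

theorem hasDerivAt_dunklEven (k : ℝ≥0) (z : ℝ) :
    HasDerivAt (dunklEven k) (2 * dunklOdd k z) z := by
  have h := (hasDerivAt_besselSeries (neg_half_le_sub k) (z ^ 2)).comp z (hasDerivAt_pow 2 z)
  rw [show (k : ℝ) - 1 / 2 + 1 = k + 1 / 2 by ring] at h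
  refine h.congr_deriv ?_
  simp only [dunklOdd]
  norm_num
  ring

/-- The last term is 2k `dunklOdd k z` / z, written without the division so as to include z = 0. -/
theorem hasDerivAt_dunklOdd (k : ℝ≥0) (z : ℝ) :
    HasDerivAt (dunklOdd k)
      (2 * dunklEven k z - 2 * k * besselSeries ((k : ℝ) + 1 / 2) (z ^ 2)) z := by
  have h := (hasDerivAt_id z).mul
    ((hasDerivAt_besselSeries (neg_half_le_add k) (z ^ 2)).comp z (hasDerivAt_pow 2 z))
  refine h.congr_deriv ?_
  have hc := besselSeries_contiguous (neg_half_le_sub k) (z ^ 2)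
  rw [show (k : ℝ) - 1 / 2 + 1 = k + 1 / 2 by ring, show (k : ℝ) - 1 / 2 + 2 = k + 1 / 2 + 1 by ring]
    at hc
  simp only [dunklEven, hc, Function.comp_apply, id]
  norm_num
  ring

theorem dunklEven_pos (k : ℝ≥0) (z : ℝ) : 0 < dunklEven k z :=
  besselSeries_pos (neg_half_le_sub k) (sq_nonneg z)

theorem dunklOdd_nonneg (k : ℝ≥0) {z : ℝ} (hz : 0 ≤ z) : 0 ≤ dunklOdd k z :=
  mul_nonneg hz (besselSeries_pos (neg_half_le_add k) (sq_nonneg z)).le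

theorem dunklEven_neg (k : ℝ≥0) (z : ℝ) : dunklEven k (-z) = dunklEven k z := by simp [dunklEven]

theorem dunklOdd_neg (k : ℝ≥0) (z : ℝ) : dunklOdd k (-z) = -dunklOdd k z := by simp [dunklOdd]

/-- With A, B the even and odd parts, e^(2u)(A-B) is nondecreasing, because A' = 2B and B' = 2A -
2kB/u, and it is positive at 0. -/
theorem dunklOdd_lt_dunklEven (k : ℝ≥0) {z : ℝ} (hz : 0 ≤ z) : dunklOdd k z < dunklEven k z := by
  have hd : ∀ u : ℝ, HasDerivAt (fun u => Real.exp (2 * u) * (dunklEven k u - dunklOdd k u))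
      (Real.exp (2 * u) * (2 * k * besselSeries ((k : ℝ) + 1 / 2) (u ^ 2))) u := fun u => by
    have h := (((hasDerivAt_id u).const_mul 2).exp).mul
      ((hasDerivAt_dunklEven k u).sub (hasDerivAt_dunklOdd k u))
    refine h.congr_deriv ?_
    simp only [id, Pi.sub_apply]
    ring
  have hm : Monotone fun u => Real.exp (2 * u) * (dunklEven k u - dunklOdd k u) :=
    monotone_of_deriv_nonneg (fun u => (hd u).differentiableAt) fun u => by
      rw [(hd u).deriv]
      have := (besselSeries_pos (neg_half_le_add k) (sq_nonneg u)).le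
      positivity
  have h := hm hz
  have h0 := dunklEven_pos k 0
  simp only [mul_zero, Real.exp_zero, one_mul, show dunklOdd k 0 = 0 by simp [dunklOdd]] at h
  have := (mul_pos_iff_of_pos_left (Real.exp_pos (2 * z))).mp
    (by linarith : 0 < Real.exp (2 * z) * (dunklEven k z - dunklOdd k z))
  linarith

theorem abs_dunklOdd_lt (k : ℝ≥0) (z : ℝ) : |dunklOdd k z| < dunklEven k z := by
  rcases le_total 0 z with h | h
  · rw [abs_of_nonneg (dunklOdd_nonneg k h)]
    exact dunklOdd_lt_dunklEven k h
  · rw [← abs_neg, ← dunklOdd_neg, ← dunklEven_neg,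
      abs_of_nonneg (dunklOdd_nonneg k (neg_nonneg.mpr h))]
    exact dunklOdd_lt_dunklEven k (neg_nonneg.mpr h)

theorem dunklEven_le_exp (k : ℝ≥0) (z : ℝ) :
    dunklEven k z ≤ dunklEven k 0 * Real.exp (2 * |z|) := by
  suffices H : ∀ z : ℝ, 0 ≤ z → dunklEven k z ≤ dunklEven k 0 * Real.exp (2 * z) by
    rcases le_total 0 z with h | h
    · rw [abs_of_nonneg h]; exact H z h
    · rw [abs_of_nonpos h, ← dunklEven_neg]; exact H _ (neg_nonneg.mpr h)
  intro z hz
  have hd : ∀ u : ℝ, HasDerivAt (fun u => Real.exp (-(2 * u)) * dunklEven k u)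
      (Real.exp (-(2 * u)) * (-2 * (dunklEven k u - dunklOdd k u))) u := fun u => by
    have h := (((hasDerivAt_id u).const_mul 2).neg.exp).mul (hasDerivAt_dunklEven k u)
    refine h.congr_deriv ?_
    simp only [id, Pi.neg_apply]
    ring
  have hm : Antitone fun u => Real.exp (-(2 * u)) * dunklEven k u :=
    antitone_of_deriv_nonpos (fun u => (hd u).differentiableAt) fun u => by
      rw [(hd u).deriv]
      have := (abs_lt.mp (abs_dunklOdd_lt k u)).2
      have := Real.exp_pos (-(2 * u))
      nlinarith
  have h := hm hz
  simp only [mul_zero, neg_zero, Real.exp_zero, one_mul, Real.exp_neg] at h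
  rwa [inv_mul_le_iff₀ (Real.exp_pos _), mul_comm] at h

/-- The cancellation estimate A - B = O(A/z). The function 2u(A-B) - 2kA has derivative
2(A-B)(1-2u), so it decreases beyond 1/2; its value at 1/2 is at most A(1/2) ≤ A(z). For z ≤ 1/2 the
bound is immediate. -/
theorem mul_dunklEven_sub_dunklOdd_le (k : ℝ≥0) {z : ℝ} (hz : 0 ≤ z) :
    2 * z * (dunklEven k z - dunklOdd k z) ≤ (2 * k + 1) * dunklEven k z := by
  have hd : ∀ u : ℝ, HasDerivAt
      (fun u => 2 * u * (dunklEven k u - dunklOdd k u) - 2 * k * dunklEven k u)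
      (2 * (dunklEven k u - dunklOdd k u) * (1 - 2 * u)) u := fun u => by
    have h := (((hasDerivAt_id u).const_mul 2).mul
      ((hasDerivAt_dunklEven k u).sub (hasDerivAt_dunklOdd k u))).sub
      ((hasDerivAt_dunklEven k u).const_mul (2 * (k : ℝ)))
    refine h.congr_deriv ?_
    simp only [id, Pi.sub_apply, dunklOdd]
    ring
  have hA := dunklEven_pos k z
  have hB := dunklOdd_nonneg k hz
  have hAB := dunklOdd_lt_dunklEven k hz
  have hk := k.coe_nonneg
  rcases le_total z (1 / 2) with h | h
  · nlinarith
  · have hm : AntitoneOn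
        (fun u => 2 * u * (dunklEven k u - dunklOdd k u) - 2 * k * dunklEven k u) (Ici (1 / 2)) :=
      antitoneOn_of_deriv_nonpos (convex_Ici _)
        (fun u _ => (hd u).continuousAt.continuousWithinAt)
        (fun u _ => (hd u).differentiableAt.differentiableWithinAt) fun u hu => by
        rw [interior_Ici, mem_Ioi] at hu
        rw [(hd u).deriv]
        have := (abs_lt.mp (abs_dunklOdd_lt k u)).2
        nlinarith
    have h1 := hm (by simp) (show z ∈ Ici (1 / 2) from h) h
    have hmono : MonotoneOn (dunklEven k) (Ici 0) :=
      monotoneOn_of_deriv_nonneg (convex_Ici _) (continuous_dunklEven k).continuousOn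
        (fun u _ => (hasDerivAt_dunklEven k u).differentiableAt.differentiableWithinAt) fun u hu => by
        rw [interior_Ici, mem_Ioi] at hu
        rw [(hasDerivAt_dunklEven k u).deriv]
        have := dunklOdd_nonneg k hu.le
        positivity
    have h2 := hmono (show (1 / 2 : ℝ) ∈ Ici 0 by norm_num) (show z ∈ Ici 0 from hz) h
    have h3 := dunklOdd_nonneg k (show (0 : ℝ) ≤ 1 / 2 by norm_num)
    have h4 := dunklEven_pos k (1 / 2)
    simp only at h1
    nlinarith

/-! ### The Mehler formula for the Dunkl-Hermite functions -/

theorem sqrt_inv_mul_self (a : ℝ) : √(a⁻¹) * a = √a := by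
  rw [Real.sqrt_inv, inv_mul_eq_div, Real.div_sqrt]

/-- In this normalization the product of two such functions carries the weight exactly once, as in
the Hille-Hardy formula. -/
theorem hermiteFun_even (k : ℝ≥0) (n : ℕ) (x : ℝ) :
    hermiteFun k (2 * n) x = (-1) ^ n * √(laguerreWeight ((k : ℝ) - 1 / 2) n) *
      (Real.exp (-x ^ 2 / 2) * lag ((k : ℝ) - 1 / 2) n (x ^ 2)) := by
  have h : (n.factorial : ℝ) / Real.Gamma (n + (k : ℝ) + 1 / 2) =
      (laguerreWeight ((k : ℝ) - 1 / 2) n)⁻¹ := by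
    rw [laguerreWeight, inv_div]
    ring_nf
  rw [hermiteFun, if_pos (even_two_mul n), Nat.mul_div_cancel_left n two_pos, h, laguerre_eq_lag,
    ← sqrt_inv_mul_self (laguerreWeight _ _)]
  ring

theorem hermiteFun_odd (k : ℝ≥0) (n : ℕ) (x : ℝ) :
    hermiteFun k (2 * n + 1) x = (-1) ^ n * √(laguerreWeight ((k : ℝ) + 1 / 2) n) *
      (Real.exp (-x ^ 2 / 2) * (x * lag ((k : ℝ) + 1 / 2) n (x ^ 2))) := by
  have h : (n.factorial : ℝ) / Real.Gamma (n + (k : ℝ) + 3 / 2) =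
      (laguerreWeight ((k : ℝ) + 1 / 2) n)⁻¹ := by
    rw [laguerreWeight, inv_div]
    ring_nf
  rw [hermiteFun, if_neg (by simp), show (2 * n + 1) / 2 = n by omega, h,
    laguerre_eq_lag, ← sqrt_inv_mul_self (laguerreWeight _ _)]
  ring

/-- The Gaussian factor of the Mehler kernel. -/
def mehlerGauss (k : ℝ≥0) (t x y : ℝ) : ℝ :=
  (2 * Real.sinh (2 * t)) ^ (-((k : ℝ) + 1 / 2)) *
    Real.exp (-(Real.cosh (2 * t) / Real.sinh (2 * t)) * (x ^ 2 + y ^ 2) / 2)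

/-- The part of the Mehler kernel that is even in each variable. -/
def mehlerEven (k : ℝ≥0) (t x y : ℝ) : ℝ :=
  mehlerGauss k t x y * dunklEven k (x * y / (2 * Real.sinh (2 * t)))

/-- The closed form of the heat kernel. -/
def mehlerKernel (k : ℝ≥0) (t x y : ℝ) : ℝ :=
  mehlerGauss k t x y * (dunklEven k (x * y / (2 * Real.sinh (2 * t))) +
    dunklOdd k (x * y / (2 * Real.sinh (2 * t))))

/-- With q = e^(-2t): 1 - q^2 = 2q sinh(2t), and the power of q this releases cancels e^(-t(2k+1)) =
q^(k+1/2). -/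
theorem exp_mul_gauss_eq_mehlerGauss (k : ℝ≥0) {t : ℝ} (ht : 0 < t) (x y : ℝ) :
    Real.exp (-t * (2 * k + 1)) * (Real.exp (-x ^ 2 / 2) * Real.exp (-y ^ 2 / 2)) *
      ((1 - Real.exp (-(2 * t)) ^ 2) ^ (-((k : ℝ) + 1 / 2)) *
        Real.exp (-(x ^ 2 + y ^ 2) * Real.exp (-(2 * t)) ^ 2 / (1 - Real.exp (-(2 * t)) ^ 2))) =
      mehlerGauss k t x y := by
  have hs : 0 < Real.sinh (2 * t) := Real.sinh_pos_iff.mpr (by linarith)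
  have hq := Real.exp_pos (-(2 * t))
  have hS : Real.sinh (2 * t) = ((Real.exp (-(2 * t)))⁻¹ - Real.exp (-(2 * t))) / 2 := by
    rw [Real.sinh_eq, ← Real.exp_neg, neg_neg]
  have hC : Real.cosh (2 * t) = ((Real.exp (-(2 * t)))⁻¹ + Real.exp (-(2 * t))) / 2 := by
    rw [Real.cosh_eq, ← Real.exp_neg, neg_neg]
  have h1 : 1 - Real.exp (-(2 * t)) ^ 2 = Real.exp (-(2 * t)) * (2 * Real.sinh (2 * t)) := by
    rw [hS]; field_simp
  have h2 : Real.exp (-t * (2 * k + 1)) * Real.exp (-(2 * t)) ^ (-((k : ℝ) + 1 / 2)) = 1 := by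
    rw [← Real.exp_mul, ← Real.exp_add, Real.exp_eq_one_iff]; ring
  have h3 : -x ^ 2 / 2 + -y ^ 2 / 2 +
      -(x ^ 2 + y ^ 2) * Real.exp (-(2 * t)) ^ 2 / (1 - Real.exp (-(2 * t)) ^ 2) =
      -(Real.cosh (2 * t) / Real.sinh (2 * t)) * (x ^ 2 + y ^ 2) / 2 := by
    have hs' := hs.ne'
    have hq2 : (Real.exp (-(2 * t)) * (2 * Real.sinh (2 * t))) ≠ 0 := by positivity
    rw [← h1] at hq2
    rw [hS] at hs'
    rw [hS, hC]
    generalize Real.exp (-(2 * t)) = q at *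
    have hq3 : 1 - q ^ 2 ≠ 0 := hq2
    have : q⁻¹ - q = (1 - q ^ 2) / q := by field_simp
    rw [this]
    field_simp
    ring
  rw [mehlerGauss, ← h3, Real.exp_add, Real.exp_add]
  nth_rewrite 1 [h1]
  rw [Real.mul_rpow hq.le (by positivity)]
  linear_combination ((Real.exp (-x ^ 2 / 2) * Real.exp (-y ^ 2 / 2)) *
    (2 * Real.sinh (2 * t)) ^ (-((k : ℝ) + 1 / 2)) *
    Real.exp (-(x ^ 2 + y ^ 2) * Real.exp (-(2 * t)) ^ 2 / (1 - Real.exp (-(2 * t)) ^ 2))) * h2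

theorem exp_div_one_sub_sq {t : ℝ} :
    Real.exp (-(2 * t)) / (1 - Real.exp (-(2 * t)) ^ 2) = 1 / (2 * Real.sinh (2 * t)) := by
  have hq := Real.exp_pos (-(2 * t))
  rw [Real.sinh_eq, show Real.exp (2 * t) = (Real.exp (-(2 * t)))⁻¹ by rw [← Real.exp_neg, neg_neg]]
  generalize Real.exp (-(2 * t)) = q at *
  rw [show 2 * ((q⁻¹ - q) / 2) = (1 - q ^ 2) / q by field_simp, one_div_div]

theorem exp_neg_two_mul_sq_lt_one {t : ℝ} (ht : 0 < t) : Real.exp (-(2 * t)) ^ 2 < 1 := by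
  have : Real.exp (-(2 * t)) < 1 := by rw [Real.exp_lt_one_iff]; linarith
  have := Real.exp_pos (-(2 * t))
  nlinarith

theorem hasSum_heat_even (k : ℝ≥0) {t : ℝ} (ht : 0 < t) (x y : ℝ) :
    HasSum (fun n : ℕ => Real.exp (-t * (2 * (2 * n : ℕ) + 2 * k + 1)) * hermiteFun k (2 * n) x *
      hermiteFun k (2 * n) y) (mehlerEven k t x y) := by
  have h := (hasSum_hilleHardy (neg_half_le_sub k) (sq_nonneg (Real.exp (-(2 * t))))
    (exp_neg_two_mul_sq_lt_one ht) (x ^ 2) (y ^ 2)).mul_left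
    (Real.exp (-t * (2 * k + 1)) * (Real.exp (-x ^ 2 / 2) * Real.exp (-y ^ 2 / 2)))
  refine h.of_eq (fun n => ?_) ?_
  · have hW := laguerreWeight_pos (show (-1 : ℝ) < k - 1 / 2 by linarith [k.coe_nonneg]) n
    have he : Real.exp (-t * (2 * (2 * n : ℕ) + 2 * k + 1)) =
        Real.exp (-t * (2 * k + 1)) * (Real.exp (-(2 * t)) ^ 2) ^ n := by
      rw [← Real.exp_nat_mul, ← Real.exp_nat_mul, ← Real.exp_add]
      push_cast; ring_nf
    have h1 : ((-1 : ℝ) ^ n) * (-1) ^ n = 1 := by rw [← mul_pow]; simp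
    rw [hermiteFun_even, hermiteFun_even, he]
    have h2 := Real.mul_self_sqrt hW.le
    generalize √(laguerreWeight ((k : ℝ) - 1 / 2) n) = r at *
    rw [← h2]
    linear_combination (Real.exp (-t * (2 * k + 1)) * (Real.exp (-(2 * t)) ^ 2) ^ n * r * r *
      Real.exp (-x ^ 2 / 2) * Real.exp (-y ^ 2 / 2) * lag ((k : ℝ) - 1 / 2) n (x ^ 2) *
      lag ((k : ℝ) - 1 / 2) n (y ^ 2)) * h1
  · rw [mehlerEven, ← exp_mul_gauss_eq_mehlerGauss k ht, dunklEven, show x * y /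
      (2 * Real.sinh (2 * t)) = x * y * (1 / (2 * Real.sinh (2 * t))) by ring, ← exp_div_one_sub_sq,
      show (k : ℝ) - 1 / 2 + 1 = k + 1 / 2 by ring]
    rw [show x ^ 2 * y ^ 2 * Real.exp (-(2 * t)) ^ 2 / (1 - Real.exp (-(2 * t)) ^ 2) ^ 2 =
      (x * y * (Real.exp (-(2 * t)) / (1 - Real.exp (-(2 * t)) ^ 2))) ^ 2 by
        rw [mul_pow, mul_pow, div_pow]; ring]
    ring

/-- Hille-Hardy with α = k + 1/2; the extra x y e^(-2t)/(1-e^(-4t)) is the factor z = xy/(2 sinh 2t)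
of `dunklOdd`. -/
theorem hasSum_heat_odd (k : ℝ≥0) {t : ℝ} (ht : 0 < t) (x y : ℝ) :
    HasSum (fun n : ℕ => Real.exp (-t * (2 * (2 * n + 1 : ℕ) + 2 * k + 1)) *
      hermiteFun k (2 * n + 1) x * hermiteFun k (2 * n + 1) y)
      (mehlerGauss k t x y * dunklOdd k (x * y / (2 * Real.sinh (2 * t)))) := by
  have hw := exp_neg_two_mul_sq_lt_one ht
  have h := (hasSum_hilleHardy (neg_half_le_add k) (sq_nonneg (Real.exp (-(2 * t))))
    hw (x ^ 2) (y ^ 2)).mul_left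
    (Real.exp (-t * (2 * k + 1)) * (Real.exp (-x ^ 2 / 2) * Real.exp (-y ^ 2 / 2)) *
      (x * y * Real.exp (-(2 * t))))
  refine h.of_eq (fun n => ?_) ?_
  · have hW := laguerreWeight_pos (show (-1 : ℝ) < k + 1 / 2 by linarith [k.coe_nonneg]) n
    have he : Real.exp (-t * (2 * (2 * n + 1 : ℕ) + 2 * k + 1)) =
        Real.exp (-t * (2 * k + 1)) * Real.exp (-(2 * t)) * (Real.exp (-(2 * t)) ^ 2) ^ n := by
      rw [← Real.exp_nat_mul, ← Real.exp_nat_mul, ← Real.exp_add, ← Real.exp_add]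
      push_cast; ring_nf
    have h1 : ((-1 : ℝ) ^ n) * (-1) ^ n = 1 := by rw [← mul_pow]; simp
    rw [hermiteFun_odd, hermiteFun_odd, he]
    have h2 := Real.mul_self_sqrt hW.le
    generalize √(laguerreWeight ((k : ℝ) + 1 / 2) n) = r at *
    rw [← h2]
    linear_combination (Real.exp (-t * (2 * k + 1)) * Real.exp (-(2 * t)) *
      (Real.exp (-(2 * t)) ^ 2) ^ n * r * r *
      Real.exp (-x ^ 2 / 2) * Real.exp (-y ^ 2 / 2) * (x * lag ((k : ℝ) + 1 / 2) n (x ^ 2)) *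
      (y * lag ((k : ℝ) + 1 / 2) n (y ^ 2))) * h1
  · rw [← exp_mul_gauss_eq_mehlerGauss k ht, dunklOdd, show x * y /
      (2 * Real.sinh (2 * t)) = x * y * (1 / (2 * Real.sinh (2 * t))) by ring, ← exp_div_one_sub_sq,
      show -((k : ℝ) + 1 / 2 + 1) = -((k : ℝ) + 1 / 2) - 1 by ring,
      Real.rpow_sub (by linarith), Real.rpow_one]
    rw [show x ^ 2 * y ^ 2 * Real.exp (-(2 * t)) ^ 2 / (1 - Real.exp (-(2 * t)) ^ 2) ^ 2 =
      (x * y * (Real.exp (-(2 * t)) / (1 - Real.exp (-(2 * t)) ^ 2))) ^ 2 by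
        rw [mul_pow, mul_pow, div_pow]; ring]
    ring

/-- The Mehler formula. -/
theorem hasSum_heatKernel (k : ℝ≥0) {t : ℝ} (ht : 0 < t) (x y : ℝ) :
    HasSum (fun n : ℕ => Real.exp (-t * (2 * n + 2 * k + 1)) * hermiteFun k n x * hermiteFun k n y)
      (mehlerKernel k t x y) := by
  rw [mehlerKernel, mul_add]
  exact HasSum.even_add_odd (f := fun n : ℕ =>
    Real.exp (-t * (2 * n + 2 * k + 1)) * hermiteFun k n x * hermiteFun k n y)
    (hasSum_heat_even k ht x y) (hasSum_heat_odd k ht x y)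

theorem heatKernel_eq (k : ℝ≥0) {t : ℝ} (ht : 0 < t) (x y : ℝ) :
    heatKernel k t x y = mehlerKernel k t x y := (hasSum_heatKernel k ht x y).tsum_eq

theorem mehlerKernel_comm (k : ℝ≥0) (t x y : ℝ) : mehlerKernel k t x y = mehlerKernel k t y x := by
  rw [mehlerKernel, mehlerKernel, mehlerGauss, mehlerGauss, mul_comm x y, add_comm (x ^ 2)]

/-! ### The Dunkl operator on the Mehler kernel. -/

theorem hasDerivAt_mehlerKernel (k : ℝ≥0) (t x y : ℝ) :
    HasDerivAt (fun u => mehlerKernel k t u y)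
      ((y / Real.sinh (2 * t) - x * (Real.cosh (2 * t) / Real.sinh (2 * t))) * mehlerKernel k t x y -
        k * (y / Real.sinh (2 * t)) * (mehlerGauss k t x y *
          besselSeries ((k : ℝ) + 1 / 2) ((x * y / (2 * Real.sinh (2 * t))) ^ 2))) x := by
  have hz : HasDerivAt (fun u => u * y / (2 * Real.sinh (2 * t))) (y / (2 * Real.sinh (2 * t))) x := by
    simpa using ((hasDerivAt_id x).mul_const y).div_const (2 * Real.sinh (2 * t))
  have hg : HasDerivAt (fun u => mehlerGauss k t u y)
      (mehlerGauss k t x y * (-(x * (Real.cosh (2 * t) / Real.sinh (2 * t))))) x := by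
    have h := ((((hasDerivAt_pow 2 x).add_const (y ^ 2)).const_mul
      (-(Real.cosh (2 * t) / Real.sinh (2 * t)))).div_const 2).exp.const_mul
      ((2 * Real.sinh (2 * t)) ^ (-((k : ℝ) + 1 / 2)))
    refine h.congr_deriv ?_
    simp only [mehlerGauss]
    norm_num
    ring
  have h := hg.mul (((hasDerivAt_dunklEven k _).comp x hz).add ((hasDerivAt_dunklOdd k _).comp x hz))
  refine h.congr_deriv ?_
  simp only [mehlerKernel, Pi.add_apply, Function.comp_apply]
  ring

/-- Reflection in x changes the sign of the odd part only, so the difference quotient cancels the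
`besselSeries` term of the derivative exactly. -/
theorem dunklOp_mehlerKernel (k : ℝ≥0) (t x y : ℝ) :
    dunklOp k (fun u => mehlerKernel k t u y) x =
      (y / Real.sinh (2 * t) - x * (Real.cosh (2 * t) / Real.sinh (2 * t))) *
        mehlerKernel k t x y := by
  rw [dunklOp, (hasDerivAt_mehlerKernel k t x y).deriv]
  split_ifs with hx
  · subst hx
    rw [(hasDerivAt_mehlerKernel k t 0 y).deriv]
    -- At x = 0 the even part is k + 1/2 times the higher series, and (1+2k)((k+1/2) - k) = k + 1/2.
    have hc := besselSeries_contiguous (neg_half_le_sub k) 0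
    rw [show (k : ℝ) - 1 / 2 + 1 = k + 1 / 2 by ring] at hc
    simp only [mehlerKernel, dunklEven, dunklOdd, zero_mul, zero_div, ne_eq, OfNat.ofNat_ne_zero,
      not_false_eq_true, zero_pow, hc]
    ring
  · have h1 : mehlerGauss k t (-x) y = mehlerGauss k t x y := by simp [mehlerGauss]
    have h2 : mehlerKernel k t x y - mehlerKernel k t (-x) y =
        2 * mehlerGauss k t x y * dunklOdd k (x * y / (2 * Real.sinh (2 * t))) := by
      rw [mehlerKernel, mehlerKernel, h1, neg_mul, neg_div, dunklEven_neg, dunklOdd_neg]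
      ring
    rw [h2, dunklOdd]
    field_simp
    ring

/-! ### The three-term recurrence and its consequences -/

/-- `h_{n-1}^k`, with `h_{-1}^k = 0`. -/
def hermitePred (k : ℝ≥0) (n : ℕ) (x : ℝ) : ℝ := if n = 0 then 0 else hermiteFun k (n - 1) x

theorem hermitePred_succ (k : ℝ≥0) (n : ℕ) : hermitePred k (n + 1) = hermiteFun k n := by
  funext x; simp [hermitePred]

theorem theta_even (k : ℝ≥0) (m : ℕ) : theta (2 * m) k = 2 * √m := by
  rw [theta, if_pos (even_two_mul m), show (2 * ((2 * m : ℕ) : ℝ)) = 2 ^ 2 * m by push_cast; ring,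
    Real.sqrt_mul (by norm_num), Real.sqrt_sq (by norm_num)]

theorem theta_odd (k : ℝ≥0) (m : ℕ) : theta (2 * m + 1) k = 2 * √(m + k + 1 / 2) := by
  rw [theta, if_neg (by simp),
    show (2 * ((2 * m + 1 : ℕ) : ℝ) + 4 * k) = 2 ^ 2 * (m + k + 1 / 2) by push_cast; ring,
    Real.sqrt_mul (by norm_num), Real.sqrt_sq (by norm_num)]

theorem theta_nonneg (n : ℕ) (k : ℝ≥0) : 0 ≤ theta n k := by
  unfold theta; split_ifs <;> positivity

theorem theta_sq_le (n : ℕ) (k : ℝ≥0) : theta n k ^ 2 ≤ 2 * n + 4 * k := by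
  have := k.coe_nonneg
  unfold theta
  split_ifs
  · rw [Real.sq_sqrt (by positivity)]; linarith
  · rw [Real.sq_sqrt (by positivity)]

theorem theta_succ_pos (n : ℕ) (k : ℝ≥0) : 0 < theta (n + 1) k := by
  unfold theta
  push_cast
  split_ifs <;> positivity

theorem sqrt_weight_odd (k : ℝ≥0) (m : ℕ) : √(laguerreWeight ((k : ℝ) + 1 / 2) m) =
    √(m + k + 1 / 2) * √(laguerreWeight ((k : ℝ) - 1 / 2) m) := by
  have hk := k.coe_nonneg
  rw [← Real.sqrt_mul (by positivity), show (k : ℝ) + 1 / 2 = k - 1 / 2 + 1 by ring,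
    laguerreWeight_add_one (by linarith)]
  ring_nf

theorem sqrt_weight_even_succ (k : ℝ≥0) (m : ℕ) :
    √((m + 1 : ℕ) : ℝ) * √(laguerreWeight ((k : ℝ) - 1 / 2) (m + 1)) =
      √(laguerreWeight ((k : ℝ) + 1 / 2) m) := by
  have hk := k.coe_nonneg
  rw [← Real.sqrt_mul (by positivity), show (k : ℝ) + 1 / 2 = k - 1 / 2 + 1 by ring,
    laguerreWeight_add_one (by linarith), ← laguerreWeight_succ (by linarith)]
  push_cast
  rfl

/-- The difference of the two ladder relations, as (T_k + x) - (T_k - x) = 2x, obtained without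
differentiating: even n rests on `lag_succ_eq`, odd n on `mul_lag_add_one`. -/
theorem hermiteFun_three_term (k : ℝ≥0) (n : ℕ) (x : ℝ) :
    2 * x * hermiteFun k n x =
      theta n k * hermitePred k n x + theta (n + 1) k * hermiteFun k (n + 1) x := by
  have hk := k.coe_nonneg
  rcases Nat.even_or_odd' n with ⟨m, rfl | rfl⟩
  · rw [hermiteFun_even, hermiteFun_odd, theta_even, theta_odd]
    have hs : √((m : ℝ) + k + 1 / 2) * √((m : ℝ) + k + 1 / 2) = m + k + 1 / 2 :=
      Real.mul_self_sqrt (by positivity)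
    rcases m with _ | m
    · have h := sqrt_weight_odd k 0
      have h1 : Real.Gamma ((k : ℝ) + 1 / 2 + 1) = (k + 1 / 2) * Real.Gamma (k + 1 / 2) :=
        Real.Gamma_add_one (by positivity)
      have h2 : lag ((k : ℝ) - 1 / 2) 0 (x ^ 2) =
          (k + 1 / 2) * lag ((k : ℝ) + 1 / 2) 0 (x ^ 2) := by
        have : 0 < Real.Gamma ((k : ℝ) + 1 / 2) := Real.Gamma_pos_of_pos (by positivity)
        rw [lag_zero, lag_zero, h1, show (k : ℝ) - 1 / 2 + 1 = k + 1 / 2 by ring]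
        field_simp
      rw [h, h2]
      simp only [CharP.cast_eq_zero, zero_add, Real.sqrt_zero, mul_zero, zero_mul, pow_zero] at hs ⊢
      linear_combination (-2 * x * √(laguerreWeight ((k : ℝ) - 1 / 2) 0) *
        Real.exp (-x ^ 2 / 2) * lag ((k : ℝ) + 1 / 2) 0 (x ^ 2)) * hs
    · rw [show 2 * (m + 1) = 2 * m + 1 + 1 by ring, hermitePred_succ, hermiteFun_odd,
        ← sqrt_weight_even_succ, sqrt_weight_odd]
      have h := lag_succ_eq (show (-1 : ℝ) < k - 1 / 2 by linarith) m (x ^ 2)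
      rw [show (k : ℝ) - 1 / 2 + 1 = k + 1 / 2 by ring] at h
      have hs' : √((m + 1 : ℕ) : ℝ) * √((m + 1 : ℕ) : ℝ) = (m + 1 : ℕ) :=
        Real.mul_self_sqrt (by positivity)
      generalize √((m + 1 : ℕ) : ℝ) = r at *
      generalize √(((m + 1 : ℕ) : ℝ) + k + 1 / 2) = s at *
      push_cast at hs hs'
      rw [h, pow_succ]
      have e1 : (m : ℝ) + (k - 1 / 2) + 2 = s * s := by rw [hs]; ring
      rw [e1, ← hs']
      ring
  · rw [hermitePred_succ, show 2 * m + 1 + 1 = 2 * (m + 1) by ring, hermiteFun_even, hermiteFun_even,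
      hermiteFun_odd, theta_even, theta_odd]
    have h := mul_lag_add_one ((k : ℝ) - 1 / 2) m (x ^ 2)
    rw [show (k : ℝ) - 1 / 2 + 1 = k + 1 / 2 by ring] at h
    have h1 := sqrt_weight_even_succ k m
    have h2 := sqrt_weight_odd k m
    rw [pow_succ (-1 : ℝ) m]
    linear_combination 2 * (-1) ^ m * Real.exp (-x ^ 2 / 2) * √(laguerreWeight ((k : ℝ) + 1 / 2) m) * h
      + 2 * (-1) ^ m * Real.exp (-x ^ 2 / 2) * lag ((k : ℝ) - 1 / 2) m (x ^ 2) * h2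
      + 2 * (-1) ^ m * Real.exp (-x ^ 2 / 2) * lag ((k : ℝ) - 1 / 2) (m + 1) (x ^ 2) * h1

theorem theta_succ_le (n : ℕ) (k : ℝ≥0) : theta (n + 1) k ≤ 2 * (2 * n + 2 * k + 1) := by
  have h := theta_sq_le (n + 1) k
  have hk := k.coe_nonneg
  have hn : (0 : ℝ) ≤ n := Nat.cast_nonneg n
  push_cast at h
  refine abs_le_of_sq_le_sq' (h.trans ?_) (by positivity) |>.2
  nlinarith

theorem mul_exp_neg_le {t : ℝ} (ht : 0 < t) (l : ℝ) : l * Real.exp (-(t / 2) * l) ≤ 2 / t := by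
  have := Real.add_one_le_exp (t / 2 * l)
  rw [show -(t / 2) * l = -(t / 2 * l) by ring, Real.exp_neg, ← div_eq_mul_inv,
    div_le_div_iff₀ (Real.exp_pos _) ht]
  linarith

/-- Half of the exponential absorbs θ; the rest is compared, through 2ab ≤ a^2 + b^2, with the
diagonal heat series at time t/2. The factor e^t makes up for the shift n → n+1. -/
theorem summable_raising (k : ℝ≥0) {t : ℝ} (ht : 0 < t) (x y : ℝ) :
    Summable fun n : ℕ => Real.exp (-t * (2 * n + 2 * k + 1)) *
      (theta (n + 1) k * hermiteFun k (n + 1) x * hermiteFun k n y) := by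
  have hx := (summable_nat_add_iff 1).mpr (hasSum_heatKernel k (half_pos ht) x x).summable
  have hy := (hasSum_heatKernel k (half_pos ht) y y).summable
  refine Summable.of_norm_bounded ((((hx.mul_left (Real.exp t)).add hy)).mul_left (2 / t))
    fun n => ?_
  set l : ℝ := 2 * n + 2 * k + 1 with hl
  have hl0 : 0 ≤ l := by positivity
  have h1 : theta (n + 1) k * Real.exp (-t * l) ≤ 4 / t * Real.exp (-(t / 2) * l) := by
    have h2 := mul_exp_neg_le ht l
    have h3 : Real.exp (-t * l) = Real.exp (-(t / 2) * l) * Real.exp (-(t / 2) * l) := by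
      rw [← Real.exp_add]; ring_nf
    have h4 := theta_succ_le n k
    rw [← hl] at h4
    have h5 := Real.exp_pos (-(t / 2) * l)
    calc theta (n + 1) k * Real.exp (-t * l) ≤ 2 * l * Real.exp (-t * l) := by gcongr
      _ = 2 * (l * Real.exp (-(t / 2) * l)) * Real.exp (-(t / 2) * l) := by rw [h3]; ring
      _ ≤ 2 * (2 / t) * Real.exp (-(t / 2) * l) := by gcongr
      _ = _ := by ring
  have h6 : Real.exp t * Real.exp (-(t / 2) * (2 * ((n + 1 : ℕ) : ℝ) + 2 * k + 1)) =
      Real.exp (-(t / 2) * l) := by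
    rw [← Real.exp_add, hl]; push_cast; ring_nf
  have h7 : |hermiteFun k (n + 1) x| * |hermiteFun k n y| ≤
      (hermiteFun k (n + 1) x * hermiteFun k (n + 1) x + hermiteFun k n y * hermiteFun k n y) / 2 := by
    nlinarith [sq_nonneg (|hermiteFun k (n + 1) x| - |hermiteFun k n y|),
      abs_mul_abs_self (hermiteFun k (n + 1) x), abs_mul_abs_self (hermiteFun k n y)]
  rw [Real.norm_eq_abs, abs_mul, abs_mul, abs_mul, Real.abs_exp, abs_of_nonneg (theta_nonneg _ _)]
  calc Real.exp (-t * l) * (theta (n + 1) k * |hermiteFun k (n + 1) x| * |hermiteFun k n y|)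
      = theta (n + 1) k * Real.exp (-t * l) * (|hermiteFun k (n + 1) x| * |hermiteFun k n y|) := by
        ring
    _ ≤ 4 / t * Real.exp (-(t / 2) * l) * ((hermiteFun k (n + 1) x * hermiteFun k (n + 1) x +
        hermiteFun k n y * hermiteFun k n y) / 2) := by gcongr
    _ = _ := by
      rw [← mul_assoc (Real.exp t), ← mul_assoc (Real.exp t), h6]
      ring

/-- `T_k + σ x` applied to the heat kernel in `x`, in closed form. -/
def ladderKernel (σ : ℝ) (k : ℝ≥0) (t x y : ℝ) : ℝ :=
  (y / Real.sinh (2 * t) - x * (Real.cosh (2 * t) / Real.sinh (2 * t)) + σ * x) *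
    mehlerKernel k t x y

/-- Lowering is raising with x and y exchanged and n shifted by one, which costs e^(-2t); the term n
= 0 vanishes as h_{-1} = 0. -/
theorem hasSum_lowering_of_raising (k : ℝ≥0) {t x y V : ℝ}
    (hV : HasSum (fun n : ℕ => Real.exp (-t * (2 * n + 2 * k + 1)) *
      (theta (n + 1) k * hermiteFun k (n + 1) y * hermiteFun k n x)) V) :
    HasSum (fun n : ℕ => Real.exp (-t * (2 * n + 2 * k + 1)) *
      (theta n k * hermitePred k n x * hermiteFun k n y)) (Real.exp (-(2 * t)) * V) := by
  rw [← hasSum_nat_add_iff' 1]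
  refine (hV.mul_left (Real.exp (-(2 * t)))).of_eq (fun n => ?_) (by simp [hermitePred])
  have he : Real.exp (-t * (2 * ((n + 1 : ℕ) : ℝ) + 2 * k + 1)) =
      Real.exp (-(2 * t)) * Real.exp (-t * (2 * n + 2 * k + 1)) := by
    rw [← Real.exp_add]; push_cast; ring_nf
  rw [hermitePred_succ, he]
  ring

/-- Let V, V' be the raising sums at (x,y) and (y,x), P the Mehler kernel, q = e^(-2t). The
recurrence gives 2xP = V + qV' and 2yP = V' + qV; solve for V, using 1 - q^2 ≠ 0. -/
theorem hasSum_raising (k : ℝ≥0) {t : ℝ} (ht : 0 < t) (x y : ℝ) :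
    HasSum (fun n : ℕ => Real.exp (-t * (2 * n + 2 * k + 1)) *
      (theta (n + 1) k * hermiteFun k (n + 1) x * hermiteFun k n y)) (-ladderKernel (-1) k t x y) := by
  have key : ∀ x y : ℝ, ∀ V V' : ℝ,
      HasSum (fun n : ℕ => Real.exp (-t * (2 * n + 2 * k + 1)) *
        (theta (n + 1) k * hermiteFun k (n + 1) x * hermiteFun k n y)) V →
      HasSum (fun n : ℕ => Real.exp (-t * (2 * n + 2 * k + 1)) *
        (theta (n + 1) k * hermiteFun k (n + 1) y * hermiteFun k n x)) V' →
      2 * x * mehlerKernel k t x y = Real.exp (-(2 * t)) * V' + V := fun x y V V' hV hV' => by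
    refine ((hasSum_heatKernel k ht x y).mul_left (2 * x)).unique
      (((hasSum_lowering_of_raising k hV').add hV).of_eq (fun n => ?_) rfl)
    linear_combination (Real.exp (-t * (2 * n + 2 * k + 1)) * hermiteFun k n y) *
      hermiteFun_three_term k n x
  have hV := (summable_raising k ht x y).hasSum
  have hV' := (summable_raising k ht y x).hasSum
  have h1 := key x y _ _ hV hV'
  have h2 := key y x _ _ hV' hV
  rw [mehlerKernel_comm] at h2
  refine hV.of_eq (fun _ => rfl) ?_
  have hs : 0 < Real.sinh (2 * t) := Real.sinh_pos_iff.mpr (by linarith)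
  have hq := Real.exp_pos (-(2 * t))
  have hw := exp_neg_two_mul_sq_lt_one ht
  have hS : Real.sinh (2 * t) = ((Real.exp (-(2 * t)))⁻¹ - Real.exp (-(2 * t))) / 2 := by
    rw [Real.sinh_eq, ← Real.exp_neg, neg_neg]
  have hC : Real.cosh (2 * t) = ((Real.exp (-(2 * t)))⁻¹ + Real.exp (-(2 * t))) / 2 := by
    rw [Real.cosh_eq, ← Real.exp_neg, neg_neg]
  rw [ladderKernel]
  generalize (∑' n : ℕ, Real.exp (-t * (2 * n + 2 * k + 1)) *
      (theta (n + 1) k * hermiteFun k (n + 1) x * hermiteFun k n y)) = V at *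
  generalize (∑' n : ℕ, Real.exp (-t * (2 * n + 2 * k + 1)) *
      (theta (n + 1) k * hermiteFun k (n + 1) y * hermiteFun k n x)) = V' at *
  rw [hS, hC]
  generalize Real.exp (-(2 * t)) = q at *
  have hq3 : 1 - q ^ 2 ≠ 0 := by linarith
  have e : q⁻¹ - q = (1 - q ^ 2) / q := by field_simp
  have e' : q⁻¹ + q = (1 + q ^ 2) / q := by field_simp
  have hVe : V = (2 * x - 2 * q * y) * mehlerKernel k t x y / (1 - q ^ 2) := by
    rw [eq_div_iff hq3]; linear_combination q * h2 - h1
  rw [hVe, e, e']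
  field_simp
  ring

theorem hasSum_lowering (k : ℝ≥0) {t : ℝ} (ht : 0 < t) (x y : ℝ) :
    HasSum (fun n : ℕ => Real.exp (-t * (2 * n + 2 * k + 1)) *
      (theta n k * hermitePred k n x * hermiteFun k n y)) (ladderKernel 1 k t x y) := by
  refine (hasSum_lowering_of_raising k (hasSum_raising k ht y x)).of_eq (fun _ => rfl) ?_
  have hs : 0 < Real.sinh (2 * t) := Real.sinh_pos_iff.mpr (by linarith)
  have hq := Real.exp_pos (-(2 * t))
  have hw := exp_neg_two_mul_sq_lt_one ht
  have hS : Real.sinh (2 * t) = ((Real.exp (-(2 * t)))⁻¹ - Real.exp (-(2 * t))) / 2 := by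
    rw [Real.sinh_eq, ← Real.exp_neg, neg_neg]
  have hC : Real.cosh (2 * t) = ((Real.exp (-(2 * t)))⁻¹ + Real.exp (-(2 * t))) / 2 := by
    rw [Real.cosh_eq, ← Real.exp_neg, neg_neg]
  rw [ladderKernel, ladderKernel, mehlerKernel_comm k t y x, hS, hC]
  generalize Real.exp (-(2 * t)) = q at *
  have hq3 : 1 - q ^ 2 ≠ 0 := by linarith
  have e : q⁻¹ - q = (1 - q ^ 2) / q := by field_simp
  have e' : q⁻¹ + q = (1 + q ^ 2) / q := by field_simp
  rw [e, e']
  field_simp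
  ring

/-! ### Pointwise bounds for the kernels -/

/-- Put v = 1/sinh(2t). For small t the factor e^(-cv) beats any power of v; for large t the half
power of v supplies e^(-t). -/
theorem exists_prefactor_bound (k : ℝ≥0) {c : ℝ} (hc : 0 < c) :
    ∃ C, 0 ≤ C ∧ ∀ t : ℝ, 0 < t → (1 + 1 / Real.sinh (2 * t)) *
      ((2 * Real.sinh (2 * t)) ^ (-((k : ℝ) + 1 / 2)) * Real.exp (-c / Real.sinh (2 * t))) ≤
        C * Real.exp (-t) := by
  -- The powers of 1 + v add up to k + 2: one from the prefactor, k from v^k, one from v^(1/2) ≤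
  -- 2e^(-t)(1+v).
  obtain ⟨N, hN⟩ := exists_nat_ge ((k : ℝ) + 2)
  have hk := k.coe_nonneg
  refine ⟨2 * (Real.exp c * (N.factorial / c ^ N)), by positivity, fun t ht => ?_⟩
  have hs : 0 < Real.sinh (2 * t) := Real.sinh_pos_iff.mpr (by linarith)
  have hv0 : 0 < (Real.sinh (2 * t))⁻¹ := by positivity
  have hsv : Real.sinh (2 * t) * (Real.sinh (2 * t))⁻¹ = 1 := mul_inv_cancel₀ hs.ne'
  have hE := Real.exp_pos (-t)
  have h1 : 1 ≤ 2 * Real.exp (-t) ^ 2 * (1 + Real.sinh (2 * t)) := by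
    have e1 : Real.exp (-t) ^ 2 = (Real.exp (2 * t))⁻¹ := by
      rw [← Real.exp_nat_mul, ← Real.exp_neg]; push_cast; ring_nf
    have e2 : Real.exp (-(2 * t)) ≤ 1 := by rw [Real.exp_le_one_iff]; linarith
    rw [e1, Real.sinh_eq, mul_comm 2, mul_assoc, le_inv_mul_iff₀ (Real.exp_pos _)]
    linarith
  rw [Real.rpow_neg (by positivity), ← Real.inv_rpow (by positivity), one_div (Real.sinh (2 * t)),
    neg_div, div_eq_mul_inv c]
  have hv' : 0 ≤ (2 * Real.sinh (2 * t))⁻¹ := by positivity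
  have h2 : (2 * Real.sinh (2 * t))⁻¹ ≤ (Real.sinh (2 * t))⁻¹ := by
    gcongr; linarith
  generalize (2 * Real.sinh (2 * t))⁻¹ = v' at *
  generalize (Real.sinh (2 * t))⁻¹ = v at *
  generalize Real.sinh (2 * t) = s at *
  have h3 : v ^ (1 / 2 : ℝ) ≤ 2 * Real.exp (-t) * (1 + v) := by
    rw [← Real.sqrt_eq_rpow, Real.sqrt_le_left (by positivity)]
    have : v ≤ 2 * Real.exp (-t) ^ 2 * (1 + v) := by
      calc v = 1 * v := by ring
        _ ≤ 2 * Real.exp (-t) ^ 2 * (1 + s) * v := by gcongr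
        _ = 2 * Real.exp (-t) ^ 2 * (s * v + v) := by ring
        _ = _ := by rw [hsv]
    have h4 : 0 ≤ Real.exp (-t) ^ 2 := by positivity
    nlinarith [mul_nonneg h4 hv0.le, mul_nonneg h4 (sq_nonneg v)]
  have h5 : v' ^ ((k : ℝ) + 1 / 2) ≤ v ^ (k : ℝ) * v ^ (1 / 2 : ℝ) := by
    rw [← Real.rpow_add hv0]
    exact Real.rpow_le_rpow hv' h2 (by positivity)
  have h6 : (1 + v) ^ N * Real.exp (-(c * v)) ≤ Real.exp c * (N.factorial / c ^ N) := by
    have h := Real.pow_div_factorial_le_exp (c * (1 + v)) (by positivity) N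
    have e : Real.exp (-(c * v)) = Real.exp c * (Real.exp (c * (1 + v)))⁻¹ := by
      rw [← Real.exp_neg, ← Real.exp_add]; ring_nf
    rw [e]
    calc (1 + v) ^ N * (Real.exp c * (Real.exp (c * (1 + v)))⁻¹)
        = Real.exp c * (((c * (1 + v)) ^ N / N.factorial) * (Real.exp (c * (1 + v)))⁻¹) *
          (N.factorial / c ^ N) := by rw [mul_pow]; field_simp
      _ ≤ Real.exp c * (Real.exp (c * (1 + v)) * (Real.exp (c * (1 + v)))⁻¹) *
          (N.factorial / c ^ N) := by gcongr
      _ = _ := by rw [mul_inv_cancel₀ (Real.exp_pos _).ne']; ring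
  calc (1 + v) * (v' ^ ((k : ℝ) + 1 / 2) * Real.exp (-(c * v)))
      ≤ (1 + v) * (v ^ (k : ℝ) * (2 * Real.exp (-t) * (1 + v)) * Real.exp (-(c * v))) := by
        gcongr
        exact h5.trans (by gcongr)
    _ ≤ (1 + v) * ((1 + v) ^ (k : ℝ) * (2 * Real.exp (-t) * (1 + v)) * Real.exp (-(c * v))) := by
        gcongr
        linarith
    _ = 2 * ((1 + v) ^ ((k : ℝ) + 2) * Real.exp (-(c * v))) * Real.exp (-t) := by
        rw [Real.rpow_add (by positivity), Real.rpow_two]; ring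
    _ ≤ 2 * ((1 + v) ^ N * Real.exp (-(c * v))) * Real.exp (-t) := by
        gcongr
        rw [← Real.rpow_natCast]
        exact Real.rpow_le_rpow_of_exponent_le (by linarith) hN
    _ ≤ 2 * (Real.exp c * (N.factorial / c ^ N)) * Real.exp (-t) := by gcongr

theorem mehlerGauss_pos (k : ℝ≥0) {t : ℝ} (ht : 0 < t) (x y : ℝ) : 0 < mehlerGauss k t x y := by
  have hs : 0 < Real.sinh (2 * t) := Real.sinh_pos_iff.mpr (by linarith)
  unfold mehlerGauss
  positivity

theorem mehlerEven_nonneg (k : ℝ≥0) {t : ℝ} (ht : 0 < t) (x y : ℝ) : 0 ≤ mehlerEven k t x y :=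
  mul_nonneg (mehlerGauss_pos k ht x y).le (dunklEven_pos k _).le

theorem mehlerKernel_nonneg (k : ℝ≥0) {t : ℝ} (ht : 0 < t) (x y : ℝ) :
    0 ≤ mehlerKernel k t x y :=
  mul_nonneg (mehlerGauss_pos k ht x y).le (by linarith [(abs_lt.mp (abs_dunklOdd_lt k
    (x * y / (2 * Real.sinh (2 * t))))).1])

/-- Since cosh ≥ 1, the Gaussian exponent and the growth e^(2|z|) of the Dunkl kernel combine into a
square of |x| - |y|. -/
theorem mehlerKernel_le (k : ℝ≥0) {t : ℝ} (ht : 0 < t) (x y : ℝ) :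
    mehlerKernel k t x y ≤ 2 * dunklEven k 0 * ((2 * Real.sinh (2 * t)) ^ (-((k : ℝ) + 1 / 2)) *
      Real.exp (-((|x| - |y|) ^ 2 / 2) / Real.sinh (2 * t))) := by
  have hs : 0 < Real.sinh (2 * t) := Real.sinh_pos_iff.mpr (by linarith)
  have h1 := (abs_lt.mp (abs_dunklOdd_lt k (x * y / (2 * Real.sinh (2 * t))))).2
  have h2 := dunklEven_le_exp k (x * y / (2 * Real.sinh (2 * t)))
  have hA := (dunklEven_pos k 0).le
  rw [mehlerKernel, mehlerGauss]
  calc _ ≤ (2 * Real.sinh (2 * t)) ^ (-((k : ℝ) + 1 / 2)) *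
        Real.exp (-(Real.cosh (2 * t) / Real.sinh (2 * t)) * (x ^ 2 + y ^ 2) / 2) *
        (2 * (dunklEven k 0 * Real.exp (2 * |x * y / (2 * Real.sinh (2 * t))|))) := by
        gcongr; linarith
    _ = 2 * dunklEven k 0 * ((2 * Real.sinh (2 * t)) ^ (-((k : ℝ) + 1 / 2)) *
        Real.exp (-(Real.cosh (2 * t) / Real.sinh (2 * t)) * (x ^ 2 + y ^ 2) / 2 +
          2 * |x * y / (2 * Real.sinh (2 * t))|)) := by rw [Real.exp_add]; ring
    _ ≤ _ := by
        gcongr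
        rw [abs_div, abs_mul, abs_of_pos (show 0 < 2 * Real.sinh (2 * t) by positivity)]
        have h3 := Real.one_le_cosh (2 * t)
        have e : -(Real.cosh (2 * t) / Real.sinh (2 * t)) * (x ^ 2 + y ^ 2) / 2 +
          2 * (|x| * |y| / (2 * Real.sinh (2 * t))) =
          (-Real.cosh (2 * t) * (x ^ 2 + y ^ 2) / 2 + |x| * |y|) / Real.sinh (2 * t) := by
          field_simp
        rw [e]
        gcongr
        rw [← sq_abs x, ← sq_abs y]
        nlinarith [sq_nonneg |x|, sq_nonneg |y|]

theorem abs_ladderKernel_le {σ : ℝ} (hσ : |σ| ≤ 1) (k : ℝ≥0) {t R : ℝ} (ht : 0 < t) {x y : ℝ}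
    (hx : |x| ≤ R) (hy : |y| ≤ R) :
    |ladderKernel σ k t x y| ≤
      2 * R * ((1 + 1 / Real.sinh (2 * t)) * mehlerKernel k t x y) := by
  have hs : 0 < Real.sinh (2 * t) := Real.sinh_pos_iff.mpr (by linarith)
  have hP := mehlerKernel_nonneg k ht x y
  have hR : 0 ≤ R := (abs_nonneg x).trans hx
  have hcoth : |Real.cosh (2 * t) / Real.sinh (2 * t)| ≤ 1 + 1 / Real.sinh (2 * t) := by
    rw [abs_of_pos (div_pos (Real.cosh_pos _) hs)]
    have e : Real.cosh (2 * t) ≤ Real.sinh (2 * t) + 1 := by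
      have := Real.cosh_sub_sinh (2 * t)
      have e2 : Real.exp (-(2 * t)) ≤ 1 := by rw [Real.exp_le_one_iff]; linarith
      linarith
    rw [div_le_iff₀ hs, add_mul, one_mul, div_mul_cancel₀ _ hs.ne']
    exact e
  rw [ladderKernel, abs_mul, abs_of_nonneg hP, ← mul_assoc]
  refine mul_le_mul_of_nonneg_right ?_ hP
  calc |y / Real.sinh (2 * t) - x * (Real.cosh (2 * t) / Real.sinh (2 * t)) + σ * x|
      ≤ |y / Real.sinh (2 * t)| + |x * (Real.cosh (2 * t) / Real.sinh (2 * t))| + |σ * x| :=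
        (abs_add_le _ _).trans (by gcongr; exact abs_sub _ _)
    _ = |y| / Real.sinh (2 * t) + |x| * |Real.cosh (2 * t) / Real.sinh (2 * t)| + |σ| * |x| := by
        rw [abs_div, abs_mul, abs_mul, abs_of_pos hs]
    _ ≤ R / Real.sinh (2 * t) + R * (1 + 1 / Real.sinh (2 * t)) + 1 * R := by gcongr
    _ = _ := by ring

theorem exists_ladderKernel_bound_of_abs_ne {σ : ℝ} (hσ : |σ| ≤ 1) (k : ℝ≥0) (R : ℝ) {d : ℝ}
    (hd : 0 < d) : ∃ C, 0 ≤ C ∧ ∀ t x y : ℝ, 0 < t → |x| ≤ R → |y| ≤ R → d ≤ |(|x| - |y|)| →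
      |ladderKernel σ k t x y| ≤ C * Real.exp (-t) := by
  obtain ⟨C, hC0, hC⟩ := exists_prefactor_bound k (show 0 < d ^ 2 / 2 by positivity)
  have hA := (dunklEven_pos k 0).le
  refine ⟨2 * |R| * (2 * dunklEven k 0 * C), by positivity, fun t x y ht hx hy hxy => ?_⟩
  have hs : 0 < Real.sinh (2 * t) := Real.sinh_pos_iff.mpr (by linarith)
  have hR : |R| = R := abs_of_nonneg ((abs_nonneg x).trans hx)
  have hd2 : d ^ 2 ≤ (|x| - |y|) ^ 2 := by rw [← sq_abs (|x| - |y|)]; gcongr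
  refine (abs_ladderKernel_le hσ k ht hx hy).trans ?_
  rw [hR]
  have hR0 : 0 ≤ R := (abs_nonneg x).trans hx
  calc 2 * R * ((1 + 1 / Real.sinh (2 * t)) * mehlerKernel k t x y)
      ≤ 2 * R * ((1 + 1 / Real.sinh (2 * t)) * (2 * dunklEven k 0 *
        ((2 * Real.sinh (2 * t)) ^ (-((k : ℝ) + 1 / 2)) *
          Real.exp (-(d ^ 2 / 2) / Real.sinh (2 * t))))) := by
        gcongr
        refine (mehlerKernel_le k ht x y).trans ?_
        gcongr
    _ = 2 * R * (2 * dunklEven k 0 * ((1 + 1 / Real.sinh (2 * t)) *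
        ((2 * Real.sinh (2 * t)) ^ (-((k : ℝ) + 1 / 2)) *
          Real.exp (-(d ^ 2 / 2) / Real.sinh (2 * t))))) := by ring
    _ ≤ 2 * R * (2 * dunklEven k 0 * (C * Real.exp (-t))) := by
        exact mul_le_mul_of_nonneg_left (mul_le_mul_of_nonneg_left (hC t ht) (by positivity))
          (by positivity)
    _ = _ := by ring

/-- For xy < 0 the kernel contains A(z) - B(z) with z ≥ m/(2 sinh 2t), so the cancellation estimate
absorbs 1/sinh(2t). -/
theorem mehlerKernel_le_of_mul_neg (k : ℝ≥0) {t m : ℝ} (ht : 0 < t) (hm : 0 < m) {x y : ℝ}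
    (hxy : x * y ≤ -m) :
    (1 + 1 / Real.sinh (2 * t)) * mehlerKernel k t x y ≤
      (1 + (2 * k + 1) / m) * mehlerEven k t x y := by
  have hs : 0 < Real.sinh (2 * t) := Real.sinh_pos_iff.mpr (by linarith)
  have hg := mehlerGauss_pos k ht x y
  obtain ⟨z, hz⟩ : ∃ z, z = -(x * y / (2 * Real.sinh (2 * t))) := ⟨_, rfl⟩
  have hz0 : m / (2 * Real.sinh (2 * t)) ≤ z := by
    rw [hz, ← neg_div]; gcongr; linarith
  have hz1 : 0 ≤ z := le_trans (by positivity) hz0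
  have hA := dunklEven_pos k z
  have hB := dunklOdd_nonneg k hz1
  have hAB := dunklOdd_lt_dunklEven k hz1
  have h := mul_dunklEven_sub_dunklOdd_le k hz1
  rw [mehlerKernel, mehlerEven, show x * y / (2 * Real.sinh (2 * t)) = -z by rw [hz]; ring,
    dunklEven_neg, dunklOdd_neg]
  have h1 : 1 / Real.sinh (2 * t) * (dunklEven k z - dunklOdd k z) ≤
      (2 * k + 1) / m * dunklEven k z := by
    have h2 : m / Real.sinh (2 * t) ≤ 2 * z := by
      calc m / Real.sinh (2 * t) = 2 * (m / (2 * Real.sinh (2 * t))) := by field_simp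
        _ ≤ _ := by gcongr
    have h3 : m / Real.sinh (2 * t) * (dunklEven k z - dunklOdd k z) ≤
        (2 * k + 1) * dunklEven k z :=
      (mul_le_mul_of_nonneg_right h2 (by linarith)).trans h
    calc 1 / Real.sinh (2 * t) * (dunklEven k z - dunklOdd k z)
        = (m / Real.sinh (2 * t) * (dunklEven k z - dunklOdd k z)) / m := by field_simp
      _ ≤ ((2 * k + 1) * dunklEven k z) / m := by gcongr
      _ = _ := by ring
  calc (1 + 1 / Real.sinh (2 * t)) * (mehlerGauss k t x y * (dunklEven k z + -dunklOdd k z))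
      = mehlerGauss k t x y * ((dunklEven k z - dunklOdd k z) +
        1 / Real.sinh (2 * t) * (dunklEven k z - dunklOdd k z)) := by ring
    _ ≤ mehlerGauss k t x y * (dunklEven k z + (2 * k + 1) / m * dunklEven k z) := by
        gcongr; linarith
    _ = _ := by ring

theorem exists_ladderKernel_bound {σ : ℝ} (hσ : |σ| ≤ 1) (k : ℝ≥0) (R : ℝ) {d : ℝ}
    (hd : 0 < d) : ∃ C, 0 ≤ C ∧ ∀ t x y : ℝ, 0 < t → |x| ≤ R → |y| ≤ R → d ≤ |x - y| →
      |ladderKernel σ k t x y| ≤ C * (Real.exp (-t) + mehlerEven k t x y) := by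
  obtain ⟨C, hC0, hC⟩ := exists_ladderKernel_bound_of_abs_ne hσ k R (half_pos hd)
  have hk := k.coe_nonneg
  refine ⟨C + 2 * |R| * (1 + (2 * k + 1) / (d ^ 2 / 16)), by positivity, fun t x y ht hx hy hxy => ?_⟩
  have hE := mehlerEven_nonneg k ht x y
  have he := Real.exp_pos (-t)
  have hR0 : 0 ≤ R := (abs_nonneg x).trans hx
  have hR : |R| = R := abs_of_nonneg hR0
  by_cases h : d / 2 ≤ |(|x| - |y|)|
  · refine (hC t x y ht hx hy h).trans ?_
    gcongr
    · exact le_add_of_nonneg_right (by positivity)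
    · linarith
  · push Not at h
    -- Nearly equal moduli with |x - y| ≥ d force opposite signs; then |x| + |y| ≥ d, so both moduli
    -- exceed d/4.
    have hneg : x * y ≤ -(d ^ 2 / 16) := by
      have h1 := abs_lt.mp h
      rcases abs_cases x with ⟨e1, _⟩ | ⟨e1, _⟩ <;> rcases abs_cases y with ⟨e2, _⟩ | ⟨e2, _⟩ <;>
        rcases abs_cases (x - y) with ⟨e3, _⟩ | ⟨e3, _⟩ <;> rw [e1, e2] at h1 <;> rw [e3] at hxy <;>
        first
        | (exfalso; linarith)
        | nlinarith
    refine (abs_ladderKernel_le hσ k ht hx hy).trans ?_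
    rw [hR]
    calc 2 * R * ((1 + 1 / Real.sinh (2 * t)) * mehlerKernel k t x y)
        ≤ 2 * R * ((1 + (2 * k + 1) / (d ^ 2 / 16)) * mehlerEven k t x y) := by
          exact mul_le_mul_of_nonneg_left
            (mehlerKernel_le_of_mul_neg k ht (by positivity) hneg) (by positivity)
      _ = (2 * R * (1 + (2 * k + 1) / (d ^ 2 / 16))) * mehlerEven k t x y := by ring
      _ ≤ _ := by
          gcongr
          · exact le_add_of_nonneg_left hC0
          · linarith

/-! ### Measurability and absolute convergence -/

theorem measurable_mehlerGauss (k : ℝ≥0) :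
    Measurable fun p : (ℝ × ℝ) × ℝ => mehlerGauss k p.2 p.1.1 p.1.2 := by
  unfold mehlerGauss
  fun_prop

theorem measurable_mehlerEven (k : ℝ≥0) :
    Measurable fun p : (ℝ × ℝ) × ℝ => mehlerEven k p.2 p.1.1 p.1.2 :=
  (measurable_mehlerGauss k).mul ((continuous_dunklEven k).measurable.comp (by fun_prop))

theorem measurable_ladderKernel (σ : ℝ) (k : ℝ≥0) :
    Measurable fun p : (ℝ × ℝ) × ℝ => ladderKernel σ k p.2 p.1.1 p.1.2 := by
  refine Measurable.mul (by fun_prop) ((measurable_mehlerGauss k).mul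
    (((continuous_dunklEven k).measurable.comp (by fun_prop)).add
      ((continuous_dunklOdd k).measurable.comp (by fun_prop))))

theorem integrableOn_exp_mul_rpow :
    IntegrableOn (fun t : ℝ => Real.exp (-t) * t ^ (-(1 / 2) : ℝ)) (Ioi 0) := by
  have h := Real.GammaIntegral_convergent (s := 1 / 2) (by norm_num)
  rwa [show (1 / 2 - 1 : ℝ) = -(1 / 2) by norm_num] at h

theorem integrableOn_ladderKernel {σ : ℝ} (hσ : |σ| ≤ 1) (k : ℝ≥0) {x y : ℝ} (hxy : |x| ≠ |y|) :
    IntegrableOn (fun t => ladderKernel σ k t x y * t ^ (-(1 / 2) : ℝ)) (Ioi 0) := by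
  obtain ⟨C, hC0, hC⟩ := exists_ladderKernel_bound_of_abs_ne hσ k (max |x| |y|)
    (abs_pos.mpr (sub_ne_zero.mpr hxy))
  refine (integrableOn_exp_mul_rpow.const_mul C).mono' ?_ ?_
  · have h := (measurable_ladderKernel σ k).comp (measurable_prodMk_left (x := (x, y)))
    exact (h.mul (by fun_prop)).aestronglyMeasurable
  · filter_upwards [ae_restrict_mem measurableSet_Ioi] with t ht
    have ht' : 0 < t := ht
    rw [norm_mul, Real.norm_of_nonneg (Real.rpow_nonneg ht'.le _), ← mul_assoc]
    exact mul_le_mul_of_nonneg_right (hC t x y ht (le_max_left _ _) (le_max_right _ _) le_rfl)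
      (Real.rpow_nonneg ht'.le _)

theorem integrandPlus_eq (k : ℝ≥0) (x y : ℝ) {t : ℝ} (ht : 0 < t) :
    integrandPlus k x y t = ladderKernel 1 k t x y * t ^ (-(1 / 2) : ℝ) := by
  have h : (fun u => heatKernel k t u y) = fun u => mehlerKernel k t u y :=
    funext fun u => heatKernel_eq k ht u y
  rw [integrandPlus, h, dunklOp_mehlerKernel, heatKernel_eq k ht, ladderKernel]
  ring

theorem integrandMinus_eq (k : ℝ≥0) (x y : ℝ) {t : ℝ} (ht : 0 < t) :
    integrandMinus k x y t = ladderKernel (-1) k t x y * t ^ (-(1 / 2) : ℝ) := by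
  have h : (fun u => heatKernel k t u y) = fun u => mehlerKernel k t u y :=
    funext fun u => heatKernel_eq k ht u y
  rw [integrandMinus, h, dunklOp_mehlerKernel, heatKernel_eq k ht, ladderKernel]
  ring

/-- The kernel `π^{-1/2} ∫_0^∞ (T_k + σ x) P_k(t,x,y) t^{-1/2} dt`. -/
def rieszKernel (σ : ℝ) (k : ℝ≥0) (x y : ℝ) : ℝ :=
  1 / √Real.pi * ∫ t in Ioi (0 : ℝ), ladderKernel σ k t x y * t ^ (-(1 / 2) : ℝ)

theorem kernelPlus_eq (k : ℝ≥0) (x y : ℝ) : kernelPlus k x y = rieszKernel 1 k x y := by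
  rw [kernelPlus, rieszKernel,
    setIntegral_congr_fun measurableSet_Ioi fun t ht => integrandPlus_eq k x y ht]

theorem kernelMinus_eq (k : ℝ≥0) (x y : ℝ) : kernelMinus k x y = rieszKernel (-1) k x y := by
  rw [kernelMinus, rieszKernel,
    setIntegral_congr_fun measurableSet_Ioi fun t ht => integrandMinus_eq k x y ht]

/-! ### Orthonormality of the Dunkl-Hermite functions -/

theorem integral_weightedMeasure (k : ℝ≥0) (f : ℝ → ℝ) :
    ∫ x, f x ∂(weightedMeasure k) = ∫ x, |x| ^ (2 * (k : ℝ)) * f x := by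
  rw [weightedMeasure, integral_withDensity_eq_integral_toReal_smul (by fun_prop) (by simp)]
  refine integral_congr_ae (Filter.Eventually.of_forall fun x => ?_)
  simp only [smul_eq_mul]
  rw [ENNReal.toReal_ofReal (by positivity)]

theorem integrable_even_moment (k : ℝ≥0) (i : ℕ) :
    Integrable (fun x : ℝ => (x ^ 2) ^ i * Real.exp (-x ^ 2)) (weightedMeasure k) := by
  refine (memLp_monomial_gauss k 1 i).integrable_sq.congr (Filter.Eventually.of_forall fun x => ?_)
  simp only [one_mul]
  rw [mul_pow, ← Real.exp_nat_mul]
  push_cast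
  ring_nf

theorem integral_even_moment (k : ℝ≥0) (i : ℕ) :
    ∫ x : ℝ, (x ^ 2) ^ i * Real.exp (-x ^ 2) ∂(weightedMeasure k) =
      Real.Gamma ((k : ℝ) - 1 / 2 + i + 1) := by
  have hk := k.coe_nonneg
  have hi : (0 : ℝ) ≤ i := Nat.cast_nonneg i
  have h1 := integral_comp_abs
    (f := fun x : ℝ => |x| ^ (2 * (k : ℝ)) * ((x ^ 2) ^ i * Real.exp (-x ^ 2)))
  simp only [abs_abs, sq_abs] at h1
  rw [integral_weightedMeasure, h1]
  have h2 := integral_rpow_mul_exp_neg_rpow (p := 2) (q := 2 * k + 2 * i) two_pos (by linarith)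
  rw [show (k : ℝ) - 1 / 2 + i + 1 = (2 * k + 2 * i + 1) / 2 by ring]
  have h3 : ∫ x in Ioi (0 : ℝ), |x| ^ (2 * (k : ℝ)) * ((x ^ 2) ^ i * Real.exp (-x ^ 2)) =
      ∫ x in Ioi (0 : ℝ), x ^ (2 * (k : ℝ) + 2 * i) * Real.exp (-x ^ (2 : ℝ)) := by
    refine setIntegral_congr_fun measurableSet_Ioi fun x hx => ?_
    have hx' : 0 < x := hx
    rw [abs_of_pos hx', Real.rpow_add hx', ← pow_mul, show (2 * (i : ℝ)) = ((2 * i : ℕ) : ℝ) by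
      push_cast; ring, Real.rpow_natCast, Real.rpow_two]
    ring
  rw [h3, h2]
  ring

theorem memLp_hermiteFun_real (k : ℝ≥0) (n : ℕ) : MemLp (hermiteFun k n) 2 (weightedMeasure k) :=
  (memLp_hermiteFun k n).re

theorem integrable_hermiteFun_mul (k : ℝ≥0) (n m : ℕ) :
    Integrable (fun x => hermiteFun k n x * hermiteFun k m x) (weightedMeasure k) :=
  (memLp_hermiteFun_real k n).integrable_mul (memLp_hermiteFun_real k m)

/-- For n = 2m each moment cancels the Γ in its coefficient, leaving the alternating sum of the
C(m,i). For odd n the integrand is odd. -/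
theorem integral_hermiteFun_mul_zero (k : ℝ≥0) (n : ℕ) :
    ∫ x, hermiteFun k n x * hermiteFun k 0 x ∂(weightedMeasure k) = if n = 0 then 1 else 0 := by
  have hα : (-1 : ℝ) < k - 1 / 2 := by linarith [k.coe_nonneg]
  have h0 := fun x => hermiteFun_even k 0 x
  simp only [mul_zero, pow_zero, one_mul] at h0
  rcases Nat.even_or_odd' n with ⟨m, rfl | rfl⟩
  · have h1 : ∀ x, hermiteFun k (2 * m) x * hermiteFun k 0 x =
        ∑ i ∈ Finset.range (m + 1), ((-1) ^ m * √(laguerreWeight ((k : ℝ) - 1 / 2) m) *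
          √(laguerreWeight ((k : ℝ) - 1 / 2) 0) * lag ((k : ℝ) - 1 / 2) 0 0 *
          ((-1) ^ i * (m.choose i : ℝ) / Real.Gamma ((k : ℝ) - 1 / 2 + i + 1))) *
          ((x ^ 2) ^ i * Real.exp (-x ^ 2)) := fun x => by
      have he : Real.exp (-x ^ 2) = Real.exp (-x ^ 2 / 2) * Real.exp (-x ^ 2 / 2) := by
        rw [← Real.exp_add]; ring_nf
      rw [hermiteFun_even, h0, lag_zero, lag_zero, lag, he]
      simp only [Finset.mul_sum, Finset.sum_mul]
      refine Finset.sum_congr rfl fun i _ => ?_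
      rw [neg_pow (x ^ 2)]
      ring
    simp only [h1]
    rw [integral_finsetSum _ fun i _ => (integrable_even_moment k i).const_mul _]
    simp only [integral_const_mul, integral_even_moment]
    have h2 : ∀ i ∈ Finset.range (m + 1), ((-1) ^ m * √(laguerreWeight ((k : ℝ) - 1 / 2) m) *
          √(laguerreWeight ((k : ℝ) - 1 / 2) 0) * lag ((k : ℝ) - 1 / 2) 0 0 *
          ((-1) ^ i * (m.choose i : ℝ) / Real.Gamma ((k : ℝ) - 1 / 2 + i + 1))) *
          Real.Gamma ((k : ℝ) - 1 / 2 + i + 1) =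
        ((-1) ^ m * √(laguerreWeight ((k : ℝ) - 1 / 2) m) *
          √(laguerreWeight ((k : ℝ) - 1 / 2) 0) * lag ((k : ℝ) - 1 / 2) 0 0) *
          ((-1) ^ i * (m.choose i : ℝ)) := fun i _ => by
      rw [mul_assoc, div_mul_cancel₀ _ (Gamma_shift_pos hα i).ne']
    rw [Finset.sum_congr rfl h2, ← Finset.mul_sum]
    have h3 := congrArg (Int.cast : ℤ → ℝ) (Int.alternating_sum_range_choose (n := m))
    push_cast at h3
    rw [h3]
    by_cases hm : m = 0
    · subst hm
      simp only [mul_zero, if_true, pow_zero, one_mul, mul_one]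
      rw [Real.mul_self_sqrt (laguerreWeight_pos hα 0).le, laguerreWeight_mul_lag_zero hα]
    · simp [hm]
  · rw [integral_weightedMeasure, if_neg (by omega)]
    set F : ℝ → ℝ := fun x =>
      |x| ^ (2 * (k : ℝ)) * (hermiteFun k (2 * m + 1) x * hermiteFun k 0 x) with hF
    have hodd : ∀ x, F (-x) = -F x := fun x => by
      simp only [hF, hermiteFun_odd, h0, abs_neg, neg_sq]
      ring
    have h := integral_neg_eq_self F volume
    simp only [hodd, integral_neg] at h
    change ∫ x, F x = 0
    linarith

/-- Multiplication by 2x is symmetric, so the three-term recurrence expresses column m+2 of the Gram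
matrix through columns m and m+1; column 0 was computed directly and θ(m+2,k) > 0. -/
theorem integral_hermiteFun_mul (k : ℝ≥0) (n m : ℕ) :
    ∫ x, hermiteFun k n x * hermiteFun k m x ∂(weightedMeasure k) = if n = m then 1 else 0 := by
  set J : ℕ → ℕ → ℝ := fun n m => ∫ x, hermiteFun k n x * hermiteFun k m x ∂(weightedMeasure k)
    with hJ
  have h0 : ∀ n, J n 0 = if n = 0 then 1 else 0 := integral_hermiteFun_mul_zero k
  have hx : ∀ n m, ∫ x, 2 * x * hermiteFun k n x * hermiteFun k m x ∂(weightedMeasure k) =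
      theta n k * (if n = 0 then 0 else J (n - 1) m) + theta (n + 1) k * J (n + 1) m := by
    intro n m
    have e : ∀ x, 2 * x * hermiteFun k n x * hermiteFun k m x =
        theta n k * (hermitePred k n x * hermiteFun k m x) +
          theta (n + 1) k * (hermiteFun k (n + 1) x * hermiteFun k m x) := fun x => by
      rw [hermiteFun_three_term]; ring
    have hi : Integrable (fun x => hermitePred k n x * hermiteFun k m x) (weightedMeasure k) := by
      rcases n with _ | n
      · simp [hermitePred]
      · rw [hermitePred_succ]; exact integrable_hermiteFun_mul k n m
    simp only [e]
    rw [integral_add (hi.const_mul _) ((integrable_hermiteFun_mul k _ _).const_mul _),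
      integral_const_mul, integral_const_mul]
    rcases n with _ | n
    · simp [hermitePred, hJ]
    · simp [hermitePred_succ, hJ]
  have hsymm : ∀ n m, theta n k * (if n = 0 then 0 else J (n - 1) m) +
      theta (n + 1) k * J (n + 1) m = theta m k * (if m = 0 then 0 else J n (m - 1)) +
        theta (m + 1) k * J n (m + 1) := by
    intro n m
    have hc : ∀ a b, J a b = J b a := fun a b => by simp only [hJ, mul_comm]
    rw [← hx n m, hc n (m - 1), hc n (m + 1), ← hx m n]
    congr 1
    funext x
    ring
  suffices H : ∀ m n, J n m = if n = m then 1 else 0 from H m n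
  intro m
  induction m using Nat.twoStepInduction with
  | zero => exact h0
  | one =>
    intro n
    have h := hsymm n 0
    have ht := theta_succ_pos 0 k
    simp only [if_true, mul_zero, zero_add, h0] at h ht
    refine mul_left_cancel₀ ht.ne' (h.symm.trans ?_)
    rcases n with _ | _ | n <;> simp
  | more m ih0 ih1 =>
    intro n
    have h := hsymm n (m + 1)
    have ht := theta_succ_pos (m + 1) k
    simp only [Nat.add_one_ne_zero, if_false, Nat.add_sub_cancel, ih0, ih1] at h
    refine mul_left_cancel₀ ht.ne' ?_
    rcases n with _ | n
    · simp only [if_true, mul_zero, zero_add] at h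
      rw [if_neg (show ¬ 0 = m + 2 by omega), mul_zero]
      rcases m with _ | m
      · rw [if_pos rfl, if_pos rfl] at h
        exact left_eq_add.mp h
      · rw [if_neg (show ¬ 1 = m + 1 + 1 by omega), if_neg (show ¬ 0 = m + 1 by omega), mul_zero,
          mul_zero, zero_add] at h
        exact h.symm
    · simp only [Nat.add_one_ne_zero, if_false, Nat.add_sub_cancel] at h
      have e1 : (theta (n + 1) k * if n = m + 1 then 1 else 0) =
          theta (m + 1 + 1) k * if n + 1 = m + 2 then 1 else 0 := by
        by_cases h1 : n = m + 1
        · subst h1; simp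
        · rw [if_neg h1, if_neg (by omega)]; simp
      have e2 : (theta (n + 1 + 1) k * if n + 1 + 1 = m + 1 then 1 else 0) =
          theta (m + 1) k * if n + 1 = m then 1 else 0 := by
        by_cases h1 : n + 1 = m
        · subst h1; simp
        · rw [if_neg h1, if_neg (by omega)]; simp
      linarith

theorem inner_hermiteLp (k : ℝ≥0) (n : ℕ) (F : Lp ℂ 2 (weightedMeasure k)) :
    inner ℂ (hermiteLp k n) F = coeff k n F := by
  rw [L2.inner_def, coeff]
  refine integral_congr_ae ?_
  filter_upwards [(memLp_hermiteFun k n).coeFn_toLp] with x hx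
  rw [RCLike.inner_apply, hermiteLp, hx, Complex.conj_ofReal]

theorem orthonormal_hermiteLp (k : ℝ≥0) : Orthonormal ℂ (hermiteLp k) := by
  rw [orthonormal_iff_ite]
  intro i j
  rw [inner_hermiteLp, coeff]
  have h : ∫ t, (hermiteLp k j) t * (hermiteFun k i t : ℂ) ∂(weightedMeasure k) =
      ∫ t, ((hermiteFun k i t * hermiteFun k j t : ℝ) : ℂ) ∂(weightedMeasure k) := by
    refine integral_congr_ae ?_
    filter_upwards [(memLp_hermiteFun k j).coeFn_toLp] with x hx
    rw [hermiteLp, hx]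
    push_cast
    ring
  rw [h, integral_complex_ofReal, integral_hermiteFun_mul]
  split_ifs <;> simp

theorem summable_coeff_sq (k : ℝ≥0) (F : Lp ℂ 2 (weightedMeasure k)) :
    Summable fun n => ‖coeff k n F‖ ^ 2 :=
  ((orthonormal_hermiteLp k).inner_products_summable (x := F)).congr fun n => by
    rw [inner_hermiteLp]

/-! ### Convergence of the Hilbert transforms -/

theorem summable_smul_of_orthonormal {E : Type*} [NormedAddCommGroup E] [InnerProductSpace ℂ E]
    [CompleteSpace E] {v : ℕ → E} (hv : Orthonormal ℂ v) {c : ℕ → ℂ}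
    (hc : Summable fun n => ‖c n‖ ^ 2) : Summable fun n => c n • v n :=
  (hv.orthogonalFamily.summable_iff_norm_sq_summable c).mpr hc

theorem theta_sq_le_eigenvalue (n : ℕ) (k : ℝ≥0) : theta n k ^ 2 ≤ 2 * (2 * n + 2 * k + 1) := by
  have := theta_sq_le n k
  have hn : (0 : ℝ) ≤ n := Nat.cast_nonneg n
  linarith

theorem theta_succ_sq_le_eigenvalue (n : ℕ) (k : ℝ≥0) :
    theta (n + 1) k ^ 2 ≤ 2 * (2 * n + 2 * k + 1) := by
  have := theta_sq_le (n + 1) k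
  have hn : (0 : ℝ) ≤ n := Nat.cast_nonneg n
  push_cast at this
  linarith

theorem eigenvalue_pos (n : ℕ) (k : ℝ≥0) : 0 < 2 * (n : ℝ) + 2 * k + 1 := by positivity

theorem sq_div_sqrt_eigenvalue_le {d : ℝ} {n : ℕ} {k : ℝ≥0} (hd : d ^ 2 ≤ 2 * (2 * n + 2 * k + 1)) :
    (d / √(2 * n + 2 * k + 1)) ^ 2 ≤ 2 := by
  rw [div_pow, Real.sq_sqrt (eigenvalue_pos n k).le, div_le_iff₀ (eigenvalue_pos n k)]
  exact hd

/-- The multipliers d_n/√λ_n are bounded by √2, so square summability persists; this is why the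
Hilbert transforms converge in L². -/
theorem summable_coeff_mul_sq (k : ℝ≥0) (F : Lp ℂ 2 (weightedMeasure k)) {d : ℕ → ℝ}
    (hd : ∀ n : ℕ, d n ^ 2 ≤ 2 * (2 * n + 2 * k + 1)) :
    Summable fun n : ℕ => ‖coeff k n F * ((d n / √(2 * n + 2 * k + 1) : ℝ) : ℂ)‖ ^ 2 := by
  refine Summable.of_nonneg_of_le (fun n => by positivity) (fun n => ?_)
    ((summable_coeff_sq k F).mul_left 2)
  rw [norm_mul, mul_pow, Complex.norm_real, Real.norm_eq_abs, sq_abs, mul_comm]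
  exact mul_le_mul_of_nonneg_right (sq_div_sqrt_eigenvalue_le (hd n)) (by positivity)

theorem summable_hilbertPlusTerm (k : ℝ≥0) (F : Lp ℂ 2 (weightedMeasure k)) :
    Summable (hilbertPlusTerm k F) := by
  rw [← summable_nat_add_iff 1]
  exact summable_smul_of_orthonormal (orthonormal_hermiteLp k) ((summable_nat_add_iff 1).mpr
    (summable_coeff_mul_sq k F fun n => theta_sq_le_eigenvalue n k))

theorem summable_hilbertMinusTerm (k : ℝ≥0) (F : Lp ℂ 2 (weightedMeasure k)) :
    Summable (hilbertMinusTerm k F) :=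
  summable_smul_of_orthonormal ((orthonormal_hermiteLp k).comp (· + 1) (add_left_injective 1))
    (summable_coeff_mul_sq k F fun n => theta_succ_sq_le_eigenvalue n k)

theorem coeff_toLp (k : ℝ≥0) (n : ℕ) {f : ℝ → ℂ} (hf : MemLp f 2 (weightedMeasure k)) :
    coeff k n (hf.toLp f) = ∫ x, f x * (hermiteFun k n x : ℂ) ∂(weightedMeasure k) := by
  rw [coeff]
  refine integral_congr_ae ?_
  filter_upwards [hf.coeFn_toLp] with x hx
  rw [hx]

/-! ### Exchanging series and integrals -/

theorem integrable_ofReal_mul {ν : Measure ℝ} {u : ℝ → ℝ} {f : ℝ → ℂ} (hu : MemLp u 2 ν)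
    (hf : MemLp f 2 ν) : Integrable (fun x => (u x : ℂ) * f x) ν :=
  (MemLp.ofReal (K := ℂ) hu).integrable_mul hf

theorem integral_norm_ofReal_mul_le {ν : Measure ℝ} {u : ℝ → ℝ} {f : ℝ → ℂ} (hu : MemLp u 2 ν)
    (hf : MemLp f 2 ν) (hu1 : ∫ x, u x ^ 2 ∂ν ≤ 1) :
    ∫ x, ‖(u x : ℂ) * f x‖ ∂ν ≤ (1 + ∫ x, ‖f x‖ ^ 2 ∂ν) / 2 := by
  have hu2 := hu.integrable_sq
  have hf2 := hf.norm.integrable_sq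
  calc ∫ x, ‖(u x : ℂ) * f x‖ ∂ν ≤ ∫ x, (u x ^ 2 + ‖f x‖ ^ 2) / 2 ∂ν := by
        refine integral_mono (integrable_ofReal_mul hu hf).norm ((hu2.add hf2).div_const 2)
          fun x => ?_
        simp only [norm_mul, Complex.norm_real, Real.norm_eq_abs]
        nlinarith [sq_nonneg (|u x| - ‖f x‖), sq_abs (u x)]
    _ = ((∫ x, u x ^ 2 ∂ν) + ∫ x, ‖f x‖ ^ 2 ∂ν) / 2 := by
        rw [integral_div, integral_add hu2 hf2]
    _ ≤ _ := by gcongr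

/-- The L¹ norms of u_n g and v_n f are bounded uniformly in n, so absolute summability of c_n
suffices to integrate termwise. -/
theorem hasSum_integral_prod {ν : Measure ℝ} [SFinite ν] {u v : ℕ → ℝ → ℝ} {c : ℕ → ℝ}
    {K : ℝ → ℝ → ℝ} {f g : ℝ → ℂ} (hu : ∀ n, MemLp (u n) 2 ν) (hu1 : ∀ n, ∫ x, u n x ^ 2 ∂ν ≤ 1)
    (hv : ∀ n, MemLp (v n) 2 ν) (hv1 : ∀ n, ∫ x, v n x ^ 2 ∂ν ≤ 1) (hc : Summable fun n => |c n|)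
    (hK : ∀ x y, HasSum (fun n => c n * (u n x * v n y)) (K x y))
    (hf : MemLp f 2 ν) (hg : MemLp g 2 ν) :
    HasSum (fun n => (c n : ℂ) * ((∫ x, (u n x : ℂ) * g x ∂ν) * ∫ y, (v n y : ℂ) * f y ∂ν))
      (∫ p, (K p.1 p.2 : ℂ) * (f p.2 * g p.1) ∂(ν.prod ν)) := by
  have h := hasSum_integral_of_summable_integral_norm (μ := ν.prod ν)
    (F := fun n p => (c n : ℂ) * (((u n p.1 : ℂ) * g p.1) * ((v n p.2 : ℂ) * f p.2)))
    (fun n => ((integrable_ofReal_mul (hu n) hg).mul_prod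
      (integrable_ofReal_mul (hv n) hf)).const_mul _) ?_
  · simp only [integral_const_mul] at h
    have e : ∀ p : ℝ × ℝ, ∑' n, (c n : ℂ) * (((u n p.1 : ℂ) * g p.1) * ((v n p.2 : ℂ) * f p.2)) =
        (K p.1 p.2 : ℂ) * (f p.2 * g p.1) := fun p => by
      have := (Complex.hasSum_ofReal.mpr (hK p.1 p.2)).mul_right (f p.2 * g p.1)
      rw [← this.tsum_eq]
      congr 1
      funext n
      push_cast
      ring
    simp only [e] at h
    convert! h using 2 with n
    rw [integral_prod_mul (fun x => (u n x : ℂ) * g x) (fun y => (v n y : ℂ) * f y)]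
  · refine Summable.of_nonneg_of_le (fun n => integral_nonneg fun _ => norm_nonneg _) (fun n => ?_)
      (hc.mul_right (((1 + ∫ x, ‖g x‖ ^ 2 ∂ν) / 2) * ((1 + ∫ x, ‖f x‖ ^ 2 ∂ν) / 2)))
    have e : ∀ p : ℝ × ℝ, ‖(c n : ℂ) * (((u n p.1 : ℂ) * g p.1) * ((v n p.2 : ℂ) * f p.2))‖ =
        |c n| * (‖(u n p.1 : ℂ) * g p.1‖ * ‖(v n p.2 : ℂ) * f p.2‖) := fun p => by
      rw [norm_mul, norm_mul, Complex.norm_real, Real.norm_eq_abs]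
    simp only [e]
    rw [integral_const_mul,
      integral_prod_mul (fun x => ‖(u n x : ℂ) * g x‖) (fun y => ‖(v n y : ℂ) * f y‖)]
    have hg' := integral_norm_ofReal_mul_le (hu n) hg (hu1 n)
    exact mul_le_mul_of_nonneg_left (mul_le_mul hg' (integral_norm_ofReal_mul_le (hv n) hf (hv1 n))
      (integral_nonneg fun _ => norm_nonneg _)
      ((integral_nonneg fun _ => norm_nonneg _).trans hg')) (abs_nonneg _)

theorem summable_exp_eigenvalue (k : ℝ≥0) {t : ℝ} (ht : 0 < t) :
    Summable fun n : ℕ => Real.exp (-t * (2 * n + 2 * k + 1)) := by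
  refine ((summable_geometric_of_lt_one (Real.exp_pos (-(2 * t))).le
    (by rw [Real.exp_lt_one_iff]; linarith)).mul_left (Real.exp (-t * (2 * k + 1)))).congr
    fun n => ?_
  rw [← Real.exp_nat_mul, ← Real.exp_add]
  ring_nf

theorem summable_exp_eigenvalue_mul (k : ℝ≥0) {t : ℝ} (ht : 0 < t) {d : ℕ → ℝ}
    (hd : ∀ n : ℕ, d n ^ 2 ≤ 2 * (2 * n + 2 * k + 1)) :
    Summable fun n : ℕ => |Real.exp (-t * (2 * n + 2 * k + 1)) * d n| := by
  refine Summable.of_nonneg_of_le (fun n => abs_nonneg _) (fun n => ?_)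
    ((summable_exp_eigenvalue k (half_pos ht)).mul_left (4 / t))
  have hl := eigenvalue_pos n k
  have hl1 : 1 ≤ 2 * (n : ℝ) + 2 * k + 1 := by
    have : 0 ≤ 2 * (n : ℝ) + 2 * k := by positivity
    linarith
  have hdn := hd n
  generalize 2 * (n : ℝ) + 2 * k + 1 = l at *
  have h1 : |d n| ≤ 2 * l := by
    refine abs_le_of_sq_le_sq (hdn.trans ?_) (by positivity)
    nlinarith
  have h2 := mul_exp_neg_le ht l
  have h3 : Real.exp (-t * l) = Real.exp (-(t / 2) * l) * Real.exp (-(t / 2) * l) := by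
    rw [← Real.exp_add]; ring_nf
  have h5 := Real.exp_pos (-(t / 2) * l)
  rw [abs_mul, Real.abs_exp]
  calc Real.exp (-t * l) * |d n| ≤ Real.exp (-t * l) * (2 * l) := by gcongr
    _ = 2 * (l * Real.exp (-(t / 2) * l)) * Real.exp (-(t / 2) * l) := by rw [h3]; ring
    _ ≤ 2 * (2 / t) * Real.exp (-(t / 2) * l) := by gcongr
    _ = _ := by ring

/-! ### The even part of the heat kernel is bounded on bounded sets in the mean -/

theorem integral_hermiteFun_sq (k : ℝ≥0) (n : ℕ) :
    ∫ x, hermiteFun k n x ^ 2 ∂(weightedMeasure k) = 1 := by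
  simpa [sq] using integral_hermiteFun_mul k n n

theorem integrable_mehlerEven (k : ℝ≥0) (R : ℝ) (t : ℝ) :
    Integrable (fun p : ℝ × ℝ => mehlerEven k t p.1 p.2)
      (((weightedMeasure k).restrict (Icc (-R) R)).prod
        ((weightedMeasure k).restrict (Icc (-R) R))) := by
  rw [Measure.prod_restrict]
  have hc : Continuous fun p : ℝ × ℝ => mehlerEven k t p.1 p.2 := by
    have := continuous_dunklEven k
    unfold mehlerEven mehlerGauss
    fun_prop
  exact hc.continuousOn.integrableOn_compact (isCompact_Icc.prod isCompact_Icc)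

/-- The integral equals the sum over even n of e^(-tλ_n) |a_n|², where a_n are the coefficients of
the indicator of [-R,R]; Bessel's inequality and λ_n ≥ 1 finish. -/
theorem exists_integral_mehlerEven_le (k : ℝ≥0) (R : ℝ) :
    ∃ C, 0 ≤ C ∧ ∀ t : ℝ, 0 < t → ∫ p, mehlerEven k t p.1 p.2
      ∂(((weightedMeasure k).restrict (Icc (-R) R)).prod
        ((weightedMeasure k).restrict (Icc (-R) R))) ≤ C * Real.exp (-t) := by
  set ν := (weightedMeasure k).restrict (Icc (-R) R) with hν
  have : IsFiniteMeasure ν :=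
    ⟨by rw [hν, Measure.restrict_apply_univ]; exact isCompact_Icc.measure_lt_top⟩
  set a : ℕ → ℂ := fun n => ∫ x, (hermiteFun k n x : ℂ) * (1 : ℂ) ∂ν with ha
  have hsum : Summable fun n => ‖a n‖ ^ 2 := by
    have hm : MemLp ((Icc (-R) R).indicator fun _ => (1 : ℂ)) 2 (weightedMeasure k) :=
      memLp_indicator_const 2 measurableSet_Icc 1 (Or.inr isCompact_Icc.measure_lt_top.ne)
    refine (summable_coeff_sq k (hm.toLp _)).congr fun n => ?_
    simp only [ha]
    rw [coeff_toLp, hν, ← integral_indicator measurableSet_Icc]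
    congr 3
    funext x
    by_cases hx : x ∈ Icc (-R) R <;> simp [hx]
  have hsum2 : Summable fun n => ‖a (2 * n)‖ ^ 2 :=
    hsum.comp_injective (mul_right_injective₀ two_ne_zero)
  refine ⟨∑' n, ‖a (2 * n)‖ ^ 2, tsum_nonneg fun n => by positivity, fun t ht => ?_⟩
  have hsq : ∀ n, ∫ x, hermiteFun k (2 * n) x ^ 2 ∂ν ≤ 1 := fun n => by
    rw [← integral_hermiteFun_sq k (2 * n)]
    exact setIntegral_le_integral (memLp_hermiteFun_real k _).integrable_sq
      (Filter.Eventually.of_forall fun x => sq_nonneg _)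
  have hmem : ∀ n, MemLp (hermiteFun k (2 * n)) 2 ν := fun n =>
    (memLp_hermiteFun_real k _).mono_measure Measure.restrict_le_self
  have h1 : MemLp (fun _ : ℝ => (1 : ℂ)) 2 ν := memLp_const 1
  have hc : Summable fun n : ℕ => |Real.exp (-t * (2 * (2 * n : ℕ) + 2 * k + 1))| := by
    simp only [Real.abs_exp]
    exact (summable_exp_eigenvalue k ht).comp_injective (mul_right_injective₀ two_ne_zero)
  have h := hasSum_integral_prod hmem hsq hmem hsq hc
    (fun x y => (hasSum_heat_even k ht x y).of_eq (fun n => by ring) rfl) h1 h1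
  simp only [mul_one] at h
  rw [integral_complex_ofReal] at h
  have hnn : 0 ≤ ∫ p, mehlerEven k t p.1 p.2 ∂(ν.prod ν) :=
    integral_nonneg fun p => mehlerEven_nonneg k ht _ _
  rw [← Real.norm_of_nonneg hnn, ← Complex.norm_real, ← tsum_mul_right]
  refine h.norm_le_of_bounded (hsum2.mul_right (Real.exp (-t))).hasSum fun n => ?_
  simp only [ha, mul_one]
  rw [norm_mul, norm_mul, Complex.norm_real, Real.norm_eq_abs, Real.abs_exp, sq, mul_comm]
  gcongr
  have : 0 ≤ t * (2 * ((2 * n : ℕ) : ℝ) + 2 * k) := by positivity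
  linarith

/-! ### The kernel representation -/

/-- The majorant is e^(-t) plus `mehlerEven`. The latter is controlled only after integration in
space, so space is integrated before time. -/
theorem integrable_ladderKernel_prod {σ : ℝ} (hσ : |σ| ≤ 1) (k : ℝ≥0) {f g : ℝ → ℂ}
    (hf : Continuous f) (hfc : HasCompactSupport f) (hg : Continuous g) (hgc : HasCompactSupport g)
    (hfg : Disjoint (tsupport f) (tsupport g)) :
    Integrable (fun z : (ℝ × ℝ) × ℝ =>
      ((ladderKernel σ k z.2 z.1.1 z.1.2 * z.2 ^ (-(1 / 2) : ℝ) : ℝ) : ℂ) * (f z.1.2 * g z.1.1))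
      (((weightedMeasure k).prod (weightedMeasure k)).prod (volume.restrict (Ioi 0))) := by
  -- A compact set and a disjoint closed set are at positive distance; δ bounds |x - y| from below
  -- on the supports.
  obtain ⟨δ, hδ, hdisj⟩ := hfg.exists_thickenings hfc (isClosed_tsupport g)
  obtain ⟨R₁, hR₁⟩ := (hfc.isCompact.isBounded).subset_closedBall 0
  obtain ⟨R₂, hR₂⟩ := (hgc.isCompact.isBounded).subset_closedBall 0
  obtain ⟨Mf, hMf⟩ := hf.bounded_above_of_compact_support hfc
  obtain ⟨Mg, hMg⟩ := hg.bounded_above_of_compact_support hgc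
  set R := max R₁ R₂
  have hfR : ∀ y, f y ≠ 0 → |y| ≤ R := fun y hy => by
    have := hR₁ (subset_tsupport f hy)
    rw [mem_closedBall_zero_iff, Real.norm_eq_abs] at this
    exact this.trans (le_max_left _ _)
  have hgR : ∀ y, g y ≠ 0 → |y| ≤ R := fun y hy => by
    have := hR₂ (subset_tsupport g hy)
    rw [mem_closedBall_zero_iff, Real.norm_eq_abs] at this
    exact this.trans (le_max_right _ _)
  have hsep : ∀ x y, g x ≠ 0 → f y ≠ 0 → δ ≤ |x - y| := fun x y hx hy => by
    by_contra hlt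
    push Not at hlt
    refine Set.disjoint_left.mp hdisj (Metric.mem_thickening_iff.mpr
      ⟨y, subset_tsupport f hy, ?_⟩) (Metric.self_subset_thickening hδ _ (subset_tsupport g hx))
    rwa [Real.dist_eq]
  obtain ⟨C, hC0, hC⟩ := exists_ladderKernel_bound hσ k R hδ
  obtain ⟨D, hD0, hD⟩ := exists_integral_mehlerEven_le k R
  have hMf0 : 0 ≤ Mf := (norm_nonneg _).trans (hMf 0)
  have hMg0 : 0 ≤ Mg := (norm_nonneg _).trans (hMg 0)
  set ν := (weightedMeasure k).restrict (Icc (-R) R) with hν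
  have : IsFiniteMeasure ν :=
    ⟨by rw [hν, Measure.restrict_apply_univ]; exact isCompact_Icc.measure_lt_top⟩
  have hmeas : Measurable (fun z : (ℝ × ℝ) × ℝ =>
      ((ladderKernel σ k z.2 z.1.1 z.1.2 * z.2 ^ (-(1 / 2) : ℝ) : ℝ) : ℂ) * (f z.1.2 * g z.1.1)) := by
    have h1 := measurable_ladderKernel σ k
    have h2 := hf.measurable
    have h3 := hg.measurable
    fun_prop
  have hsupp : Function.support (fun z : (ℝ × ℝ) × ℝ =>
      ((ladderKernel σ k z.2 z.1.1 z.1.2 * z.2 ^ (-(1 / 2) : ℝ) : ℝ) : ℂ) * (f z.1.2 * g z.1.1)) ⊆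
      (Icc (-R) R ×ˢ Icc (-R) R) ×ˢ univ := fun z hz => by
    have h1 := right_ne_zero_of_mul hz
    exact ⟨⟨abs_le.mp (hgR _ (right_ne_zero_of_mul h1)), abs_le.mp (hfR _ (left_ne_zero_of_mul h1))⟩,
      mem_univ _⟩
  -- Restricting space to [-R,R]² makes the measures finite, so that constants become integrable.
  rw [← integrableOn_iff_integrable_of_support_subset hsupp, IntegrableOn,
    ← Measure.prod_restrict, Measure.restrict_univ, ← Measure.prod_restrict, ← hν]
  have hB1 : Integrable (fun z : (ℝ × ℝ) × ℝ => (1 : ℝ) * (Real.exp (-z.2) * z.2 ^ (-(1 / 2) : ℝ)))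
      ((ν.prod ν).prod (volume.restrict (Ioi 0))) :=
    (integrable_const (1 : ℝ)).mul_prod integrableOn_exp_mul_rpow
  have hB2 : Integrable (fun z : (ℝ × ℝ) × ℝ => mehlerEven k z.2 z.1.1 z.1.2 * z.2 ^ (-(1 / 2) : ℝ))
      ((ν.prod ν).prod (volume.restrict (Ioi 0))) := by
    have hm : Measurable (fun z : (ℝ × ℝ) × ℝ =>
        mehlerEven k z.2 z.1.1 z.1.2 * z.2 ^ (-(1 / 2) : ℝ)) :=
      (measurable_mehlerEven k).mul (by fun_prop)
    rw [integrable_prod_iff' hm.aestronglyMeasurable]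
    refine ⟨Filter.Eventually.of_forall fun t => 
      (integrable_mehlerEven k R t).mul_const (t ^ (-(1 / 2) : ℝ)), ?_⟩
    refine (integrableOn_exp_mul_rpow.const_mul D).mono' ?_ ?_
    · exact (hm.aestronglyMeasurable (μ := (ν.prod ν).prod
        (volume.restrict (Ioi 0)))).norm.prod_swap.integral_prod_right'
    · filter_upwards [ae_restrict_mem measurableSet_Ioi] with t ht
      have ht' : 0 < t := ht
      rw [Real.norm_of_nonneg (integral_nonneg fun _ => norm_nonneg _)]
      have e : ∀ p : ℝ × ℝ, ‖mehlerEven k t p.1 p.2 * t ^ (-(1 / 2) : ℝ)‖ =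
          mehlerEven k t p.1 p.2 * t ^ (-(1 / 2) : ℝ) := fun p =>
        Real.norm_of_nonneg (mul_nonneg (mehlerEven_nonneg k ht' _ _) (Real.rpow_nonneg ht'.le _))
      simp only [e]
      rw [integral_mul_const, ← mul_assoc]
      exact mul_le_mul_of_nonneg_right (hD t ht') (Real.rpow_nonneg ht'.le _)
  refine ((hB1.add hB2).const_mul (C * (Mf * Mg))).mono' hmeas.aestronglyMeasurable ?_
  have hpos : ∀ᵐ z : (ℝ × ℝ) × ℝ ∂((ν.prod ν).prod (volume.restrict (Ioi 0))), z.2 ∈ Ioi (0 : ℝ) :=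
    Measure.quasiMeasurePreserving_snd.ae (ae_restrict_mem measurableSet_Ioi)
  filter_upwards [hpos] with z hz
  have hz' : 0 < z.2 := hz
  have hr := Real.rpow_nonneg hz'.le (-(1 / 2))
  have hE := mehlerEven_nonneg k hz' z.1.1 z.1.2
  rw [norm_mul, Complex.norm_real, norm_mul, norm_mul, Real.norm_eq_abs, Real.norm_of_nonneg hr]
  simp only [Pi.add_apply]
  by_cases h0 : f z.1.2 = 0 ∨ g z.1.1 = 0
  · have : ‖f z.1.2‖ * ‖g z.1.1‖ = 0 := by rcases h0 with h | h <;> simp [h]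
    rw [this, mul_zero]
    positivity
  · push Not at h0
    calc |ladderKernel σ k z.2 z.1.1 z.1.2| * z.2 ^ (-(1 / 2) : ℝ) * (‖f z.1.2‖ * ‖g z.1.1‖)
        ≤ (C * (Real.exp (-z.2) + mehlerEven k z.2 z.1.1 z.1.2)) * z.2 ^ (-(1 / 2) : ℝ) *
          (Mf * Mg) := by
          gcongr
          · exact hC _ _ _ hz' (hgR _ h0.2) (hfR _ h0.1) (hsep _ _ h0.2 h0.1)
          · exact hMf _
          · exact hMg _
      _ = _ := by ring

theorem integral_rpow_mul_exp_eigenvalue {l : ℝ} (hl : 0 < l) :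
    ∫ t in Ioi (0 : ℝ), t ^ (-(1 / 2) : ℝ) * Real.exp (-t * l) = √Real.pi / √l := by
  have h := Real.integral_rpow_mul_exp_neg_mul_Ioi (a := 1 / 2) (r := l) (by norm_num) hl
  rw [Real.Gamma_one_half_eq, ← Real.sqrt_eq_rpow, Real.sqrt_div zero_le_one, Real.sqrt_one,
    show (1 / 2 - 1 : ℝ) = -(1 / 2) by norm_num] at h
  rw [show √Real.pi / √l = 1 / √l * √Real.pi by ring, ← h]
  simp only [neg_mul, mul_comm l]

theorem integrableOn_rpow_mul_exp_eigenvalue {l : ℝ} (hl : 0 < l) :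
    IntegrableOn (fun t : ℝ => t ^ (-(1 / 2) : ℝ) * Real.exp (-t * l)) (Ioi 0) := by
  -- The integral of a non-integrable function is 0 by convention, whereas this one is positive.
  by_contra h
  have h1 := integral_rpow_mul_exp_eigenvalue hl
  rw [integral_undef h] at h1
  have : 0 < √Real.pi / √l := div_pos (Real.sqrt_pos.mpr Real.pi_pos) (Real.sqrt_pos.mpr hl)
  linarith

/-- Treats both signs at once: d_n u_n plays the role of (T_k + σx) h_n. -/
theorem rieszKernel_representation {σ : ℝ} (hσ : |σ| ≤ 1) (k : ℝ≥0) {u : ℕ → ℝ → ℝ} {d : ℕ → ℝ}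
    (hu : ∀ n, MemLp (u n) 2 (weightedMeasure k))
    (hu1 : ∀ n, ∫ x, u n x ^ 2 ∂(weightedMeasure k) ≤ 1)
    (hd : ∀ n : ℕ, d n ^ 2 ≤ 2 * (2 * n + 2 * k + 1))
    (hK : ∀ t : ℝ, 0 < t → ∀ x y, HasSum (fun n : ℕ => Real.exp (-t * (2 * n + 2 * k + 1)) *
      (d n * u n x * hermiteFun k n y)) (ladderKernel σ k t x y))
    {f g : ℝ → ℂ} (hf : Continuous f) (hfc : HasCompactSupport f) (hg : Continuous g)
    (hgc : HasCompactSupport g) (hfg : Disjoint (tsupport f) (tsupport g))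
    (hb : Summable fun n => ‖∫ x, (u n x : ℂ) * g x ∂(weightedMeasure k)‖ ^ 2) :
    Integrable (fun p : ℝ × ℝ => (rieszKernel σ k p.1 p.2 : ℂ) * f p.2 * g p.1)
      ((weightedMeasure k).prod (weightedMeasure k)) ∧
    HasSum (fun n : ℕ => ((d n / √(2 * n + 2 * k + 1) : ℝ) : ℂ) *
        ((∫ x, (u n x : ℂ) * g x ∂(weightedMeasure k)) *
          ∫ y, (hermiteFun k n y : ℂ) * f y ∂(weightedMeasure k)))
      (∫ p, (rieszKernel σ k p.1 p.2 : ℂ) * f p.2 * g p.1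
        ∂((weightedMeasure k).prod (weightedMeasure k))) := by
  set μ := weightedMeasure k with hμ
  have hfL : MemLp f 2 μ := hf.memLp_of_hasCompactSupport hfc
  have hgL : MemLp g 2 μ := hg.memLp_of_hasCompactSupport hgc
  have hI := integrable_ladderKernel_prod hσ k hf hfc hg hgc hfg
  have hker : ∀ p : ℝ × ℝ, (rieszKernel σ k p.1 p.2 : ℂ) * f p.2 * g p.1 =
      ((1 / √Real.pi : ℝ) : ℂ) * ∫ t in Ioi (0 : ℝ),
        ((ladderKernel σ k t p.1 p.2 * t ^ (-(1 / 2) : ℝ) : ℝ) : ℂ) * (f p.2 * g p.1) := fun p => by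
    rw [integral_mul_const, integral_complex_ofReal, rieszKernel]
    push_cast
    ring
  refine ⟨(hI.integral_prod_left.const_mul ((1 / √Real.pi : ℝ) : ℂ)).congr
    (Filter.Eventually.of_forall fun p => (hker p).symm), ?_⟩
  simp only [hker]
  rw [integral_const_mul, integral_integral_swap hI]
  set a : ℕ → ℂ := fun n => ∫ y, (hermiteFun k n y : ℂ) * f y ∂μ with ha
  set b : ℕ → ℂ := fun n => ∫ x, (u n x : ℂ) * g x ∂μ with hb'
  have hasq : Summable fun n => ‖a n‖ ^ 2 := by
    refine (summable_coeff_sq k (hfL.toLp f)).congr fun n => ?_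
    rw [coeff_toLp, ha]
    simp only [mul_comm, hμ]
  have hab : Summable fun n => ‖b n‖ * ‖a n‖ := by
    refine Summable.of_nonneg_of_le (fun n => by positivity) (fun n => ?_) (hb.add hasq)
    nlinarith [sq_nonneg (‖b n‖ - ‖a n‖), sq_nonneg ‖b n‖, sq_nonneg ‖a n‖]
  have hslice : ∀ t : ℝ, 0 < t →
      HasSum (fun n : ℕ => ((t ^ (-(1 / 2) : ℝ) * Real.exp (-t * (2 * n + 2 * k + 1)) : ℝ) : ℂ) *
        ((d n : ℂ) * (b n * a n)))
      (∫ p : ℝ × ℝ, ((ladderKernel σ k t p.1 p.2 * t ^ (-(1 / 2) : ℝ) : ℝ) : ℂ) *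
        (f p.2 * g p.1) ∂(μ.prod μ)) := fun t ht => by
    have h := (hasSum_integral_prod (c := fun n : ℕ => Real.exp (-t * (2 * n + 2 * k + 1)) * d n)
      hu hu1 (memLp_hermiteFun_real k) (fun n => (integral_hermiteFun_sq k n).le)
      (summable_exp_eigenvalue_mul k ht hd)
      (fun x y => (hK t ht x y).of_eq (fun n => by ring) rfl) hfL hgL).mul_left
      ((t ^ (-(1 / 2) : ℝ) : ℝ) : ℂ)
    rw [← integral_const_mul] at h
    convert! h using 2 with n
    · push_cast
      ring
    · funext p
      push_cast
      ring
  -- Integration in t turns e^(-tλ_n) into √π/√λ_n. As |d_n|/√λ_n ≤ 2, the norms are dominated by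
  -- the summable products of the coefficients of f and g.
  have hF := hasSum_integral_of_summable_integral_norm (μ := volume.restrict (Ioi (0 : ℝ)))
    (F := fun (n : ℕ) (t : ℝ) =>
      ((t ^ (-(1 / 2) : ℝ) * Real.exp (-t * (2 * n + 2 * k + 1)) : ℝ) : ℂ) *
        ((d n : ℂ) * (b n * a n)))
    (fun n => (integrableOn_rpow_mul_exp_eigenvalue (eigenvalue_pos n k)).ofReal.mul_const _) ?_
  · rw [setIntegral_congr_fun measurableSet_Ioi fun t ht => (hslice t ht).tsum_eq] at hF
    convert! hF.mul_left ((1 / √Real.pi : ℝ) : ℂ) using 2 with n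
    have hl := eigenvalue_pos n k
    rw [integral_mul_const, integral_complex_ofReal, integral_rpow_mul_exp_eigenvalue hl,
      show d n / √(2 * n + 2 * k + 1) = 1 / √Real.pi * (√Real.pi / √(2 * n + 2 * k + 1)) * d n by
        have := Real.sqrt_pos.mpr Real.pi_pos
        field_simp]
    push_cast
    ring
  · refine Summable.of_nonneg_of_le (fun n => integral_nonneg fun _ => norm_nonneg _) (fun n => ?_)
      (hab.mul_left (√Real.pi * 2))
    have hl := eigenvalue_pos n k
    have e : ∀ t ∈ Ioi (0 : ℝ), ‖((t ^ (-(1 / 2) : ℝ) * Real.exp (-t * (2 * n + 2 * k + 1)) : ℝ) : ℂ) *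
        ((d n : ℂ) * (b n * a n))‖ = t ^ (-(1 / 2) : ℝ) * Real.exp (-t * (2 * n + 2 * k + 1)) *
          (|d n| * (‖b n‖ * ‖a n‖)) := fun t ht => by
      rw [norm_mul, norm_mul, norm_mul, Complex.norm_real, Complex.norm_real, Real.norm_eq_abs (d n),
        Real.norm_of_nonneg (mul_nonneg (Real.rpow_nonneg (le_of_lt ht) _) (Real.exp_pos _).le)]
    rw [setIntegral_congr_fun measurableSet_Ioi e, integral_mul_const,
      integral_rpow_mul_exp_eigenvalue hl]
    have h2 : |d n| / √(2 * n + 2 * k + 1) ≤ 2 := by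
      rw [← abs_of_pos (Real.sqrt_pos.mpr hl), ← abs_div]
      refine abs_le_of_sq_le_sq ((sq_div_sqrt_eigenvalue_le (hd n)).trans ?_) two_pos.le
      norm_num
    calc √Real.pi / √(2 * n + 2 * k + 1) * (|d n| * (‖b n‖ * ‖a n‖))
        = √Real.pi * (|d n| / √(2 * n + 2 * k + 1)) * (‖b n‖ * ‖a n‖) := by ring
      _ ≤ √Real.pi * 2 * (‖b n‖ * ‖a n‖) := by gcongr

/-! ### Pairings with test functions -/

theorem pairing_eq_inner (k : ℝ≥0) (F : Lp ℂ 2 (weightedMeasure k)) {g : ℝ → ℂ}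
    (hg : Continuous g) (hgc : HasCompactSupport g) :
    pairing k F g = inner ℂ (toL2 k g hg hgc) F := by
  rw [L2.inner_def, pairing]
  refine integral_congr_ae ?_
  filter_upwards [(hg.memLp_of_hasCompactSupport (μ := weightedMeasure k) (p := 2) hgc).coeFn_toLp]
    with x hx
  rw [RCLike.inner_apply, toL2, hx]

theorem inner_toL2_hermiteLp (k : ℝ≥0) (n : ℕ) {g : ℝ → ℂ} (hg : Continuous g)
    (hgc : HasCompactSupport g) :
    inner ℂ (toL2 k g hg hgc) (hermiteLp k n) =
      ∫ x, (hermiteFun k n x : ℂ) * conj (g x) ∂(weightedMeasure k) := by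
  rw [← pairing_eq_inner, pairing]
  refine integral_congr_ae ?_
  filter_upwards [(memLp_hermiteFun k n).coeFn_toLp] with x hx
  rw [hermiteLp, hx]

theorem summable_hermite_conj_sq (k : ℝ≥0) {g : ℝ → ℂ} (hg : Continuous g)
    (hgc : HasCompactSupport g) :
    Summable fun n => ‖∫ x, (hermiteFun k n x : ℂ) * conj (g x) ∂(weightedMeasure k)‖ ^ 2 :=
  (summable_coeff_sq k (toL2 k g hg hgc)).congr fun n => by
    rw [← inner_toL2_hermiteLp k n hg hgc, ← inner_hermiteLp, norm_inner_symm]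

theorem coeff_toL2 (k : ℝ≥0) (n : ℕ) {f : ℝ → ℂ} (hf : Continuous f) (hfc : HasCompactSupport f) :
    coeff k n (toL2 k f hf hfc) = ∫ y, (hermiteFun k n y : ℂ) * f y ∂(weightedMeasure k) := by
  rw [toL2, coeff_toLp]
  simp only [mul_comm]

theorem hasCompactSupport_conj {g : ℝ → ℂ} (hgc : HasCompactSupport g) :
    HasCompactSupport fun x => conj (g x) := hgc.comp_left (map_zero _)

theorem tsupport_conj_subset (g : ℝ → ℂ) : tsupport (fun x => conj (g x)) ⊆ tsupport g :=
  closure_mono fun x hx hgx => hx (by simp [hgx])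

theorem hermitePred_memLp (k : ℝ≥0) (n : ℕ) : MemLp (hermitePred k n) 2 (weightedMeasure k) := by
  rcases n with _ | n
  · have : hermitePred k 0 = fun _ => 0 := by funext x; simp [hermitePred]
    rw [this]
    exact MemLp.zero
  · rw [hermitePred_succ]
    exact memLp_hermiteFun_real k n

theorem integral_hermitePred_sq_le (k : ℝ≥0) (n : ℕ) :
    ∫ x, hermitePred k n x ^ 2 ∂(weightedMeasure k) ≤ 1 := by
  rcases n with _ | n
  · simp [hermitePred]
  · rw [hermitePred_succ]
    exact (integral_hermiteFun_sq k n).le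

theorem hilbertPlus_representation (k : ℝ≥0) {f g : ℝ → ℂ} (hf : Continuous f)
    (hfc : HasCompactSupport f) (hg : Continuous g) (hgc : HasCompactSupport g)
    (hfg : Disjoint (tsupport f) (tsupport g)) :
    Integrable (fun p : ℝ × ℝ => (kernelPlus k p.1 p.2 : ℂ) * f p.2 * conj (g p.1))
        ((weightedMeasure k).prod (weightedMeasure k)) ∧
      pairing k (hilbertPlus k (toL2 k f hf hfc)) g =
        ∫ x, ∫ y, (kernelPlus k x y : ℂ) * f y * conj (g x)
          ∂(weightedMeasure k) ∂(weightedMeasure k) := by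
  obtain ⟨hI, hS⟩ := rieszKernel_representation (σ := 1) (by simp) k
    (g := fun x => conj (g x)) (u := hermitePred k) (d := fun n => theta n k) (hermitePred_memLp k)
    (integral_hermitePred_sq_le k) (fun n => theta_sq_le_eigenvalue n k)
    (fun t ht x y => hasSum_lowering k ht x y) hf hfc (Complex.continuous_conj.comp hg)
    (hasCompactSupport_conj hgc) (hfg.mono_right (tsupport_conj_subset g))
    -- Shifting by one drops h_{-1} = 0 and leaves Bessel's inequality for g.
    ((summable_nat_add_iff 1).mp ((summable_hermite_conj_sq k hg hgc).congr fun n => by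
      rw [hermitePred_succ]))
  simp only [← kernelPlus_eq] at hI hS
  refine ⟨hI, ?_⟩
  rw [← integral_prod _ hI, pairing_eq_inner k _ hg hgc, hilbertPlus]
  refine ((summable_hilbertPlusTerm k (toL2 k f hf hfc)).hasSum.mapL
    (innerSL ℂ (toL2 k g hg hgc))).unique ?_
  convert! hS using 2 with n
  rw [innerSL_apply_apply, hilbertPlusTerm, inner_smul_right, coeff_toL2]
  rcases n with _ | n
  · simp [hermitePred]
  · rw [if_neg (Nat.succ_ne_zero n), Nat.add_sub_cancel, inner_toL2_hermiteLp, hermitePred_succ]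
    ring

theorem hilbertMinus_representation (k : ℝ≥0) {f g : ℝ → ℂ} (hf : Continuous f)
    (hfc : HasCompactSupport f) (hg : Continuous g) (hgc : HasCompactSupport g)
    (hfg : Disjoint (tsupport f) (tsupport g)) :
    Integrable (fun p : ℝ × ℝ => (kernelMinus k p.1 p.2 : ℂ) * f p.2 * conj (g p.1))
        ((weightedMeasure k).prod (weightedMeasure k)) ∧
      pairing k (hilbertMinus k (toL2 k f hf hfc)) g =
        ∫ x, ∫ y, (kernelMinus k x y : ℂ) * f y * conj (g x)
          ∂(weightedMeasure k) ∂(weightedMeasure k) := by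
  -- Here d_n = -θ(n+1,k), the sign in (T_k - x) h_n = -θ(n+1,k) h_{n+1}; it matches the minus sign
  -- in the definition of `hilbertMinus`.
  obtain ⟨hI, hS⟩ := rieszKernel_representation (σ := -1) (by simp) k
    (g := fun x => conj (g x)) (u := fun n => hermiteFun k (n + 1)) (d := fun n => -theta (n + 1) k)
    (fun n => memLp_hermiteFun_real k _)
    (fun n => (integral_hermiteFun_sq k _).le)
    (fun n => by rw [neg_sq]; exact theta_succ_sq_le_eigenvalue n k)
    (fun t ht x y => (hasSum_raising k ht x y).neg.of_eq (fun n => by ring) (by ring))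
    hf hfc (Complex.continuous_conj.comp hg)
    (hasCompactSupport_conj hgc) (hfg.mono_right (tsupport_conj_subset g))
    ((summable_nat_add_iff 1).mpr (summable_hermite_conj_sq k hg hgc))
  simp only [← kernelMinus_eq] at hI hS
  refine ⟨hI, ?_⟩
  rw [← integral_prod _ hI, pairing_eq_inner k _ hg hgc, hilbertMinus, inner_neg_right]
  refine ((summable_hilbertMinusTerm k (toL2 k f hf hfc)).hasSum.mapL
    (innerSL ℂ (toL2 k g hg hgc))).neg.unique ?_
  convert! hS using 2 with n
  rw [innerSL_apply_apply, hilbertMinusTerm, inner_smul_right, coeff_toL2, inner_toL2_hermiteLp]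
  push_cast
  ring

end DunklHermite

end

/-! ### The main theorem. -/

theorem mainTheorem8 (k : ℝ≥0) :
    -- the heat kernel series converges, and its sum is differentiable in `x`
    (∀ t : ℝ, 0 < t → ∀ x y : ℝ,
      (Summable fun n : ℕ => Real.exp (-t * (2 * n + 2 * k + 1)) *
        DunklHermite.hermiteFun k n x * DunklHermite.hermiteFun k n y) ∧
      DifferentiableAt ℝ (fun u => DunklHermite.heatKernel k t u y) x) ∧
    -- the integrals defining the kernels converge absolutely
    (∀ x y : ℝ, |x| ≠ |y| →
      IntegrableOn (DunklHermite.integrandPlus k x y) (Ioi 0) ∧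
      IntegrableOn (DunklHermite.integrandMinus k x y) (Ioi 0)) ∧
    -- the Hilbert transforms are given by convergent series in `L²`
    (∀ F : Lp ℂ 2 (DunklHermite.weightedMeasure k),
      Summable (DunklHermite.hilbertPlusTerm k F) ∧
      Summable (DunklHermite.hilbertMinusTerm k F)) ∧
    -- the kernel representation
    ∀ (f g : ℝ → ℂ) (hf : ContDiff ℝ ∞ f) (hfc : HasCompactSupport f)
      (_hg : ContDiff ℝ ∞ g) (_hgc : HasCompactSupport g)
      (_hfg : Disjoint (tsupport f) (tsupport g)),
      (Integrable (fun p : ℝ × ℝ =>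
          (DunklHermite.kernelPlus k p.1 p.2 : ℂ) * f p.2 * conj (g p.1))
          ((DunklHermite.weightedMeasure k).prod (DunklHermite.weightedMeasure k)) ∧
        DunklHermite.pairing k
            (DunklHermite.hilbertPlus k (DunklHermite.toL2 k f hf.continuous hfc)) g =
          ∫ x, ∫ y, (DunklHermite.kernelPlus k x y : ℂ) * f y * conj (g x)
            ∂(DunklHermite.weightedMeasure k) ∂(DunklHermite.weightedMeasure k)) ∧
      (Integrable (fun p : ℝ × ℝ =>
          (DunklHermite.kernelMinus k p.1 p.2 : ℂ) * f p.2 * conj (g p.1))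
          ((DunklHermite.weightedMeasure k).prod (DunklHermite.weightedMeasure k)) ∧
        DunklHermite.pairing k
            (DunklHermite.hilbertMinus k (DunklHermite.toL2 k f hf.continuous hfc)) g =
          ∫ x, ∫ y, (DunklHermite.kernelMinus k x y : ℂ) * f y * conj (g x)
            ∂(DunklHermite.weightedMeasure k) ∂(DunklHermite.weightedMeasure k)) := by
  refine ⟨fun t ht x y => ⟨(DunklHermite.hasSum_heatKernel k ht x y).summable, ?_⟩,
    fun x y hxy => ⟨?_, ?_⟩, fun F => ⟨DunklHermite.summable_hilbertPlusTerm k F,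
      DunklHermite.summable_hilbertMinusTerm k F⟩, fun f g hf hfc hg hgc hfg =>
      ⟨DunklHermite.hilbertPlus_representation k hf.continuous hfc hg.continuous hgc hfg,
        DunklHermite.hilbertMinus_representation k hf.continuous hfc hg.continuous hgc hfg⟩⟩
  -- Differentiability is read off the closed form rather than the series.
  · rw [funext fun u => DunklHermite.heatKernel_eq k ht u y]
    exact (DunklHermite.hasDerivAt_mehlerKernel k t x y).differentiableAt
  · exact (DunklHermite.integrableOn_ladderKernel (σ := 1) (by simp) k hxy).congr_fun
      (fun t ht => (DunklHermite.integrandPlus_eq k x y ht).symm) measurableSet_Ioi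
  · exact (DunklHermite.integrableOn_ladderKernel (σ := -1) (by simp) k hxy).congr_fun
      (fun t ht => (DunklHermite.integrandMinus_eq k x y ht).symm) measurableSet_Ioi
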